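/- **Setting.** Let $X,U_1,U_2,Y$ be Banach spaces over $\mathbb K\in\{\mathbb R,\mathbb C\}$. Let $A$ generate a $C_0$-semigroup $(T(t))_{t\ge0}$ on $X$, let $\beta\in\rho(A)$, let $X_1=D(A)$ with norm $\|(\beta-A)x\|_X$, and let $X_{-1}$ be the completion of $X$ for the norm $\|(\beta-A)^{-1}x\|_X$; $T_{-1}(t)$ and $(\alpha-A_{-1})^{-1}$ denote the continuous extensions of $T(t)$ and $(\alpha-A)^{-1}$ to $X_{-1}$. Let $B_i\in\mathcal L(U_i,X_{-1})$ for $i=1,2$ and $C\in\mathcal L(X_1,Y)$. Assume that $Y\subseteq X$ with continuous embedding and that $C$ has an extension in $\mathcal L(X)$. Let $N:X\times Y\to U_2$ be continuous and bilinear with $$\|N(z,y)\|_{U_2}\le K\|z\|_X\|y\|_X^{1-p}\|y\|_Y^p\qquad(z\in X,\ y\in Y)$$ for some $K>0$ and $p\in(0,1)$. **Well-posedness.** Let $\omega_0\in[-\infty,\infty)$ be the growth bound of $(T(t))_{t\ge 0}$. The linear system $\dot x=Ax+B_1u_1+B_2u_2$, $y=Cx$ is ($L^2$-)well-posed, with transfer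 functions $G_1,G_2$, if for $i=1,2$: 1. for some $t>0$, $\Phi^i_tu=\int_0^tT_{-1}(t-s)B_iu(s)\,ds$ defines an operator in $\mathcal L(L^2(0,t;U_i),X)$ (and then for all $t$); 2. for some $t>0$, $x\mapsto CT(\cdot)x$, $x\in D(A)$, extends to an operator $\Psi_t\in\mathcal L(X,L^2(0,t;Y))$ (and then for all $t$); 3. $G_i:\{\alpha\in\mathbb K:\operatorname{Re}\alpha>\omega_0\}\to\mathcal L(U_i,Y)$ satisfies $G_i(\alpha)-G_i(\alpha')=C[(\alpha-A_{-1})^{-1}-(\alpha'-A_{-1})^{-1}]B_i$ and is bounded on $\{\operatorname{Re}\alpha>\gamma\}$ for some real $\gamma\ge\omega_0$; 4. for every $t\ge0$ the input-output map $$(\mathbb F^i_tu)(s)=C\Big[\int_0^sT_{-1}(s-r)B_iu(r)\,dr-(\alpha-A_{-1})^{-1}B_iu(s)\Big]+G_i(\alpha)u(s),$$ defined for $u\in W^{1,2}_{\rm loc}(0,\infty;U_i)$ with $u(0)=0$ and independent of $\alpha$ with $\operatorname{Re}\alpha>\omega_0$, extends to an operator in $\mathcal L(L^2(0,t;U_i),L^2(0,t;Y))$.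 **Solutions.** Functions $z\in C([0,\infty);X)$ and $y\in L^2_{\rm loc}([0,\infty);Y)$ are a (mild) solution and output of the bilinear feedback system $$\dot z=Az+B_1u_1+B_2N(z,y),\qquad z(0)=z_0,\qquad y=Cz$$ if $N(z,y)\in L^2_{\rm loc}([0,\infty);U_2)$ and, for all $t\ge0$, $$z(t)=T(t)z_0+\Phi^1_tu_1+\Phi^2_tN(z,y),\qquad y|_{[0,t]}=\Psi_tz_0+\mathbb F^1_tu_1+\mathbb F^2_tN(z,y).$$ For $\omega>0$ let $L^2_\omega(0,\infty;U_1)$ be the space of all $u\in L^2(0,\infty;U_1)$ with $e^{\omega\cdot}u\in L^2(0,\infty;U_1)$, with norm $\|u\|_{L^2_\omega}=\|e^{\omega\cdot}u\|_{L^2}$. **Theorem.** Let $M,\lambda>0$ be such that $\|T(t)\|\le Me^{-\lambda t}$ for all $t\ge0$, and let the linear system be well-posed with transfer functions $G_1,G_2$. Then for every $\omega\in(0,\lambda)$ there are $k>0$ and $\varepsilon_0>0$ such that for every $\varepsilon\in(0,\varepsilon_0]$ and all $z_0\in X$, $u_1\in L^2_\omega(0,\infty;U_1)$ with $$\|z_0\|_X+\|u_1\|_{L^2_\omega(0,\infty;U_1)}\le\varepsilon,$$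 the bilinear feedback system has a solution and output $(z,y)$ with $z$ bounded on $[0,\infty)$ and $y\in L^2(0,\infty;Y)$, it is the only pair of a solution and output (with $y$ unique almost everywhere), and $$\|z(t)\|_X\le k\,\varepsilon\,e^{-\omega t}\qquad\text{for all }t\ge0.$$ -/

import Mathlib

open MeasureTheory Set Filter Topology
open scoped NNReal ENNReal

noncomputable section

namespace BilinearFeedback

/-! ### Strongly continuous semigroups and their generators -/

/-- A `C₀`-semigroup `(T(t))_{t ≥ 0}` of bounded operators on `X`. -/
structure C0Semigroup (𝕜 X : Type*) [RCLike 𝕜] [NormedAddCommGroup X] [NormedSpace 𝕜 X] where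
  toFun : ℝ≥0 → X →L[𝕜] X
  map_zero : toFun 0 = ContinuousLinearMap.id 𝕜 X
  map_add : ∀ s t, toFun (s + t) = (toFun s).comp (toFun t)
  continuous_orbit : ∀ x, Continuous fun t => toFun t x

variable {𝕜 X U Y : Type*} [RCLike 𝕜]
  [NormedAddCommGroup X] [NormedSpace 𝕜 X]
  [NormedAddCommGroup U] [NormedSpace 𝕜 U]
  [NormedAddCommGroup Y] [NormedSpace 𝕜 Y]

instance : CoeFun (C0Semigroup 𝕜 X) fun _ => ℝ≥0 → X →L[𝕜] X := ⟨C0Semigroup.toFun⟩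

namespace C0Semigroup

variable (T : C0Semigroup 𝕜 X)

/-- `y = lim_{h ↓ 0} (T(h)x - x) / h`. -/
def HasRightDeriv (x y : X) : Prop :=
  Tendsto (fun h : ℝ≥0 => (((h : ℝ) : 𝕜)⁻¹) • (T h x - x)) (𝓝[>] 0) (𝓝 y)

variable {T}

theorem HasRightDeriv.add {x x' y y' : X} (h : T.HasRightDeriv x y) (h' : T.HasRightDeriv x' y') :
    T.HasRightDeriv (x + x') (y + y') := by
  refine (Tendsto.add h h').congr fun s => ?_
  rw [_root_.map_add, ← smul_add]
  congr 1
  abel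

theorem HasRightDeriv.smul {x y : X} (c : 𝕜) (h : T.HasRightDeriv x y) :
    T.HasRightDeriv (c • x) (c • y) := by
  refine (Tendsto.const_smul h c).congr fun s => ?_
  rw [map_smul, ← smul_sub, smul_comm]

theorem HasRightDeriv.zero : T.HasRightDeriv (0 : X) 0 := by
  simp [HasRightDeriv]

theorem HasRightDeriv.unique {x y y' : X} (h : T.HasRightDeriv x y) (h' : T.HasRightDeriv x y') :
    y = y' :=
  tendsto_nhds_unique h h'

variable (T)

/-- The generator `A` of the semigroup: `D(A)` consists of all `x` for which
`A x = lim_{h ↓ 0} (T(h)x - x) / h` exists. -/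
def generator : X →ₗ.[𝕜] X where
  domain :=
    { carrier := {x | ∃ y, T.HasRightDeriv x y}
      add_mem' := fun ⟨y, hy⟩ ⟨y', hy'⟩ => ⟨y + y', hy.add hy'⟩
      zero_mem' := ⟨0, HasRightDeriv.zero⟩
      smul_mem' := fun c _ ⟨y, hy⟩ => ⟨c • y, hy.smul c⟩ }
  toFun :=
    { toFun := fun x => x.2.choose
      map_add' := fun x x' =>
        (x + x').2.choose_spec.unique (x.2.choose_spec.add x'.2.choose_spec)
      map_smul' := fun c x => (c • x).2.choose_spec.unique (x.2.choose_spec.smul c) }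

theorem hasRightDeriv_generator (x : T.generator.domain) :
    T.HasRightDeriv (x : X) (T.generator x) :=
  x.2.choose_spec

theorem HasRightDeriv.orbit {T : C0Semigroup 𝕜 X} {x y : X} (h : T.HasRightDeriv x y) (t : ℝ≥0) :
    T.HasRightDeriv (T t x) (T t y) := by
  refine (((T t).continuous.tendsto y).comp h).congr fun s => ?_
  have hcomm : T s (T t x) = T t (T s x) := by
    rw [← ContinuousLinearMap.comp_apply, ← ContinuousLinearMap.comp_apply, ← T.map_add,
      ← T.map_add, add_comm]
  simp [hcomm, map_smul, map_sub]

/-- `T(t)` maps `D(A)` into itself. -/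
def onDomain (t : ℝ≥0) (x : T.generator.domain) : T.generator.domain :=
  ⟨T t x, ⟨T t (T.generator x), (T.hasRightDeriv_generator x).orbit t⟩⟩

theorem generator_onDomain (t : ℝ≥0) (x : T.generator.domain) :
    T.generator (T.onDomain t x) = T t (T.generator x) :=
  (T.hasRightDeriv_generator _).unique ((T.hasRightDeriv_generator x).orbit t)

/-- The growth bound `ω₀ = inf {v | ∃ M, ∀ t ≥ 0, ‖T(t)‖ ≤ M e^{vt}}`, possibly `-∞`. -/
def growthBound : EReal :=
  sInf ((fun v : ℝ => (v : EReal)) '' {v : ℝ | ∃ M : ℝ, ∀ t : ℝ≥0, ‖T t‖ ≤ M * Real.exp (v * t)})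

/-- The half-plane `{s | Re s > ω₀}` (a half-line if the scalars are real). -/
def rightHalfPlane : Set 𝕜 :=
  {s | T.growthBound < ((RCLike.re s : ℝ) : EReal)}

/-- `R` is a bounded two-sided inverse of `α - A : D(A) → X`. -/
def IsResolventAt (α : 𝕜) (R : X →L[𝕜] X) : Prop :=
  (∀ x, ∃ h : R x ∈ T.generator.domain, α • R x - T.generator ⟨R x, h⟩ = x) ∧
    ∀ x : T.generator.domain, R (α • (x : X) - T.generator x) = x

/-- The resolvent set `ρ(A)`. -/
def resolventSet : Set 𝕜 :=
  {α | ∃ R, T.IsResolventAt α R}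

open Classical in
/-- The resolvent `(α - A)⁻¹`, for `α ∈ ρ(A)`. -/
def resolvent (α : 𝕜) : X →L[𝕜] X :=
  if h : ∃ R, T.IsResolventAt α R then h.choose else 0

theorem isResolventAt_resolvent {α : 𝕜} (h : α ∈ T.resolventSet) :
    T.IsResolventAt α (T.resolvent α) := by
  have h' : ∃ R, T.IsResolventAt α R := h
  rw [resolvent, dif_pos h']
  exact h'.choose_spec

theorem resolvent_injective {α : 𝕜} (h : α ∈ T.resolventSet) :
    Function.Injective (T.resolvent α) := by
  rw [injective_iff_map_eq_zero]
  intro x hx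
  obtain ⟨hd, he⟩ := (T.isResolventAt_resolvent h).1 x
  have : (⟨T.resolvent α x, hd⟩ : T.generator.domain) = 0 := Subtype.ext hx
  rw [this, hx] at he
  simpa using he.symm

theorem resolvent_comm {α : 𝕜} (h : α ∈ T.resolventSet) (t : ℝ≥0) (x : X) :
    T.resolvent α (T t x) = T t (T.resolvent α x) := by
  obtain ⟨hd, he⟩ := (T.isResolventAt_resolvent h).1 x
  have h1 := (T.isResolventAt_resolvent h).2 (T.onDomain t ⟨_, hd⟩)
  rw [generator_onDomain] at h1
  have h2 : α • ((T.onDomain t ⟨_, hd⟩ : T.generator.domain) : X)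
      - T t (T.generator ⟨_, hd⟩) = T t x := by
    conv_rhs => rw [← he]
    simp [onDomain]
  rw [h2] at h1
  exact h1

/-! ### The inter- and extrapolation spaces -/

/-- The space `X₁`: the domain `D(A)` with the norm `‖x‖_{X₁} = ‖(β - A)x‖`. -/
def X1 (_β : T.resolventSet) : Type _ := T.generator.domain

/-- The space `X` with the norm `‖(β - A)⁻¹ x‖`. -/
def PreExtrapolation (_β : T.resolventSet) : Type _ := X

variable (β : T.resolventSet)

instance : AddCommGroup (T.X1 β) := inferInstanceAs (AddCommGroup T.generator.domain)

instance : Module 𝕜 (T.X1 β) := inferInstanceAs (Module 𝕜 T.generator.domain)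

instance : AddCommGroup (T.PreExtrapolation β) := inferInstanceAs (AddCommGroup X)

instance : Module 𝕜 (T.PreExtrapolation β) := inferInstanceAs (Module 𝕜 X)

/-- The inclusion `X₁ → X`. -/
def X1.incl : T.X1 β →ₗ[𝕜] X := T.generator.domain.subtype

/-- The map `β - A : X₁ → X`. -/
def X1.shift : T.X1 β →ₗ[𝕜] X :=
  (β : 𝕜) • T.generator.domain.subtype - T.generator.toFun

theorem X1.shift_injective : Function.Injective (X1.shift T β) := by
  intro x y hxy
  change T.generator.domain at x y
  have hx := (T.isResolventAt_resolvent β.2).2 x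
  have hy := (T.isResolventAt_resolvent β.2).2 y
  have h : (β : 𝕜) • (x : X) - T.generator x = (β : 𝕜) • (y : X) - T.generator y := hxy
  rw [h, hy] at hx
  exact (Subtype.ext hx).symm

/-- The orbit map `T(t) : X₁ → X₁`. -/
def X1.orbit (t : ℝ≥0) (x : T.X1 β) : T.X1 β := T.onDomain t x

/-- `(β - A)⁻¹` as a linear map on the space to be completed. -/
def PreExtrapolation.res : T.PreExtrapolation β →ₗ[𝕜] X :=
  (T.resolvent (β : 𝕜) : X →ₗ[𝕜] X)

instance : NormedAddCommGroup (T.X1 β) :=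
  NormedAddCommGroup.induced (T.X1 β) X (X1.shift T β) (X1.shift_injective T β)

instance : NormedSpace 𝕜 (T.X1 β) := NormedSpace.induced 𝕜 (T.X1 β) X (X1.shift T β)

instance : NormedAddCommGroup (T.PreExtrapolation β) :=
  NormedAddCommGroup.induced (T.PreExtrapolation β) X (PreExtrapolation.res T β)
    (T.resolvent_injective β.2)

instance : NormedSpace 𝕜 (T.PreExtrapolation β) :=
  NormedSpace.induced 𝕜 (T.PreExtrapolation β) X (PreExtrapolation.res T β)

/-- The extrapolation space `X₋₁`: the completion of `X` for the norm `‖(β - A)⁻¹ x‖`. -/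
def Xm1 : Type _ := UniformSpace.Completion (T.PreExtrapolation β)

instance : NormedAddCommGroup (T.Xm1 β) :=
  inferInstanceAs (NormedAddCommGroup (UniformSpace.Completion (T.PreExtrapolation β)))

instance : NormedSpace 𝕜 (T.Xm1 β) :=
  inferInstanceAs (NormedSpace 𝕜 (UniformSpace.Completion (T.PreExtrapolation β)))

instance : CompleteSpace (T.Xm1 β) :=
  inferInstanceAs (CompleteSpace (UniformSpace.Completion (T.PreExtrapolation β)))

/-- The real structure, used for Bochner integrals in `X₋₁`. -/
instance : NormedSpace ℝ (T.Xm1 β) := NormedSpace.restrictScalars ℝ 𝕜 (T.Xm1 β)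

/-- The embedding `X → X₋₁`. -/
def emb : X →ₗ[𝕜] T.Xm1 β :=
  (UniformSpace.Completion.toComplₗᵢ (𝕜 := 𝕜) (E := T.PreExtrapolation β)).toLinearMap

theorem norm_emb (x : X) : ‖T.emb β x‖ = ‖T.resolvent (β : 𝕜) x‖ :=
  (UniformSpace.Completion.toComplₗᵢ (𝕜 := 𝕜) (E := T.PreExtrapolation β)).norm_map x

theorem emb_injective : Function.Injective (T.emb β) :=
  (UniformSpace.Completion.toComplₗᵢ (𝕜 := 𝕜) (E := T.PreExtrapolation β)).injective

theorem denseRange_emb : DenseRange (T.emb β) :=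
  UniformSpace.Completion.denseRange_coe (α := T.PreExtrapolation β)

/-- `T₋₁(t)`: the continuous extension of `T(t)` to `X₋₁`. -/
def Tm1 (t : ℝ≥0) : T.Xm1 β →L[𝕜] T.Xm1 β :=
  ((T.emb β).comp (T t : X →ₗ[𝕜] X)).extendOfNorm (T.emb β)

theorem Tm1_emb (t : ℝ≥0) (x : X) : T.Tm1 β t (T.emb β x) = T.emb β (T t x) := by
  refine LinearMap.extendOfNorm_eq (T.denseRange_emb β) ⟨‖T t‖, fun x => ?_⟩ x
  simp only [LinearMap.comp_apply, ContinuousLinearMap.coe_coe, norm_emb]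
  rw [T.resolvent_comm β.2]
  exact (T t).le_opNorm _

/-- `(α - A₋₁)⁻¹ : X₋₁ → X`, for `α ∈ ρ(A)`: the continuous extension of `(α - A)⁻¹` to `X₋₁`,
where `A₋₁` with domain `X` is the generator of `(T₋₁(t))_{t ≥ 0}`. -/
def resolventm1 [CompleteSpace X] (α : 𝕜) : T.Xm1 β →L[𝕜] X :=
  (T.resolvent α : X →ₗ[𝕜] X).extendOfNorm (T.emb β)

theorem resolvent_eq {α : 𝕜} (hα : α ∈ T.resolventSet) (x : X) :
    T.resolvent α x = T.resolvent (β : 𝕜) x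
      + ((β : 𝕜) - α) • T.resolvent α (T.resolvent (β : 𝕜) x) := by
  obtain ⟨hd, he⟩ := (T.isResolventAt_resolvent β.2).1 x
  have h := (T.isResolventAt_resolvent hα).2 ⟨_, hd⟩
  have hx : x = (α • T.resolvent (β : 𝕜) x - T.generator ⟨_, hd⟩)
      + ((β : 𝕜) - α) • T.resolvent (β : 𝕜) x := by
    conv_lhs => rw [← he]
    module
  conv_lhs => rw [hx]
  rw [_root_.map_add, map_smul, h]

theorem resolventm1_emb [CompleteSpace X] {α : 𝕜} (hα : α ∈ T.resolventSet) (x : X) :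
    T.resolventm1 β α (T.emb β x) = T.resolvent α x := by
  refine LinearMap.extendOfNorm_eq (T.denseRange_emb β)
    ⟨1 + ‖(β : 𝕜) - α‖ * ‖T.resolvent α‖, fun x => ?_⟩ x
  rw [norm_emb, ContinuousLinearMap.coe_coe, T.resolvent_eq β hα x]
  refine (norm_add_le _ _).trans ?_
  rw [norm_smul, add_mul, one_mul, mul_assoc]
  gcongr
  exact (T.resolvent α).le_opNorm _

end C0Semigroup

/-! ### Well-posed linear systems -/

/-- The space `L²(0,t;E)`. -/
abbrev L2 (t : ℝ≥0) (E : Type*) [NormedAddCommGroup E] :=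
  Lp E 2 ((volume : Measure ℝ).restrict (Ioc 0 (t : ℝ)))

/-- `u ∈ L²_loc([0,∞);E)`. -/
def L2loc {E : Type*} [NormedAddCommGroup E] (u : ℝ → E) : Prop :=
  ∀ t : ℝ≥0, MemLp u 2 ((volume : Measure ℝ).restrict (Ioc 0 (t : ℝ)))

/-- `u` is (the continuous representative of) a function in `W^{1,2}_loc(0,∞;U)` with `u(0) = 0`,
that is, a primitive vanishing at `0` of a function `v ∈ L²_loc`, the weak derivative of `u`. -/
def W12locZero (𝕜 : Type*) {U : Type*} [RCLike 𝕜] [NormedAddCommGroup U] [NormedSpace 𝕜 U]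
    (u : ℝ → U) : Prop :=
  letI : NormedSpace ℝ U := NormedSpace.restrictScalars ℝ 𝕜 U
  ∃ v : ℝ → U, L2loc v ∧ ∀ t : ℝ, 0 ≤ t → u t = ∫ s in Ioc 0 t, v s

section System

variable (T : C0Semigroup 𝕜 X) (β : T.resolventSet)

/-- The integral `∫₀ᵗ T₋₁(t - s) B u(s) ds`, taken in `X₋₁`. -/
def inputIntegral (B : U →L[𝕜] T.Xm1 β) (u : ℝ → U) (t : ℝ) : T.Xm1 β :=
  ∫ s in Ioc 0 t, T.Tm1 β (t - s).toNNReal (B (u s))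

/-- `Φ ∈ L(L²(0,t;U), X)` is given by `Φ u = ∫₀ᵗ T₋₁(t - s) B u(s) ds`. -/
def IsInputMap (B : U →L[𝕜] T.Xm1 β) (t : ℝ≥0) (Φ : L2 t U →L[𝕜] X) : Prop :=
  ∀ u : L2 t U, T.emb β (Φ u) = inputIntegral T β B u t

/-- `B` is an `L²`-admissible control operator. -/
def AdmissibleControl (B : U →L[𝕜] T.Xm1 β) : Prop :=
  ∃ t : ℝ≥0, 0 < t ∧ ∃ Φ : L2 t U →L[𝕜] X, IsInputMap T β B t Φ

open Classical in
/-- The input map `Φ_t` of an admissible control operator. -/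
def inputMap (B : U →L[𝕜] T.Xm1 β) (t : ℝ≥0) : L2 t U →L[𝕜] X :=
  if h : ∃ Φ, IsInputMap T β B t Φ then h.choose else 0

/-- `Ψ ∈ L(X, L²(0,t;Y))` extends `x ↦ C T(·) x`, `x ∈ D(A)`. -/
def IsOutputMap (C : T.X1 β →L[𝕜] Y) (t : ℝ≥0) (Ψ : X →L[𝕜] L2 t Y) : Prop :=
  ∀ x : T.X1 β, Ψ (C0Semigroup.X1.incl T β x)
    =ᵐ[volume.restrict (Ioc 0 (t : ℝ))] fun s => C (C0Semigroup.X1.orbit T β s.toNNReal x)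

/-- `C` is an `L²`-admissible observation operator. -/
def AdmissibleObservation (C : T.X1 β →L[𝕜] Y) : Prop :=
  ∃ t : ℝ≥0, 0 < t ∧ ∃ Ψ : X →L[𝕜] L2 t Y, IsOutputMap T β C t Ψ

open Classical in
/-- The output map `Ψ_t` of an admissible observation operator. -/
def outputMap (C : T.X1 β →L[𝕜] Y) (t : ℝ≥0) : X →L[𝕜] L2 t Y :=
  if h : ∃ Ψ, IsOutputMap T β C t Ψ then h.choose else 0

/-- `G` is a transfer function of `(A, B, C)` on the half-plane `Re s > ω₀`:
`G(α) - G(α') = C [(α - A₋₁)⁻¹ - (α' - A₋₁)⁻¹] B`. -/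
def IsTransferFunction [CompleteSpace X] (B : U →L[𝕜] T.Xm1 β) (C : T.X1 β →L[𝕜] Y) (G : 𝕜 → U →L[𝕜] Y) : Prop :=
  ∀ α ∈ T.rightHalfPlane, ∀ α' ∈ T.rightHalfPlane, ∀ u : U, ∃ x : T.X1 β,
    C0Semigroup.X1.incl T β x = T.resolventm1 β α (B u) - T.resolventm1 β α' (B u) ∧
      G α u - G α' u = C x

/-- `G` is bounded on some right half-plane `Re s > γ`. -/
def BoundedOnHalfPlane (G : 𝕜 → U →L[𝕜] Y) : Prop :=
  ∃ γ : ℝ, T.growthBound ≤ γ ∧ ∃ c : ℝ, ∀ s : 𝕜, γ < RCLike.re s → ‖G s‖ ≤ c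

/-- `F ∈ L(L²(0,t;U), L²(0,t;Y))` extends
`(F u)(s) = C [∫₀ˢ T₋₁(s - r) B u(r) dr - (α - A₋₁)⁻¹ B u(s)] + G(α) u(s)`,
defined for `u ∈ W^{1,2}_loc(0,∞;U)` with `u(0) = 0`. -/
def IsInputOutputMap [CompleteSpace X] (B : U →L[𝕜] T.Xm1 β) (C : T.X1 β →L[𝕜] Y) (G : 𝕜 → U →L[𝕜] Y) (t : ℝ≥0)
    (F : L2 t U →L[𝕜] L2 t Y) : Prop :=
  ∀ u : ℝ → U, W12locZero 𝕜 u → ∀ v : L2 t U, v =ᵐ[volume.restrict (Ioc 0 (t : ℝ))] u →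
    ∀ α ∈ T.rightHalfPlane, ∀ᵐ s ∂(volume.restrict (Ioc 0 (t : ℝ))), ∃ x : T.X1 β,
      T.emb β (C0Semigroup.X1.incl T β x)
          = inputIntegral T β B u s - T.emb β (T.resolventm1 β α (B (u s))) ∧
        F v s = C x + G α (u s)

open Classical in
/-- The input-output map `𝔽_t`. -/
def inputOutputMap [CompleteSpace X] (B : U →L[𝕜] T.Xm1 β) (C : T.X1 β →L[𝕜] Y) (G : 𝕜 → U →L[𝕜] Y) (t : ℝ≥0) :
    L2 t U →L[𝕜] L2 t Y :=
  if h : ∃ F, IsInputOutputMap T β B C G t F then h.choose else 0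

variable {U₁ U₂ : Type*} [NormedAddCommGroup U₁] [NormedSpace 𝕜 U₁]
  [NormedAddCommGroup U₂] [NormedSpace 𝕜 U₂]
  (B₁ : U₁ →L[𝕜] T.Xm1 β) (B₂ : U₂ →L[𝕜] T.Xm1 β) (C : T.X1 β →L[𝕜] Y)
  (G₁ : 𝕜 → U₁ →L[𝕜] Y) (G₂ : 𝕜 → U₂ →L[𝕜] Y)

/-- The linear system `ẋ = A x + B₁ u₁ + B₂ u₂`, `y = C x`, with transfer functions `G₁`, `G₂`,
is `L²`-well-posed. -/
structure WellPosed [CompleteSpace X] : Prop where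
  control₁ : AdmissibleControl T β B₁
  control₂ : AdmissibleControl T β B₂
  observation : AdmissibleObservation T β C
  transfer₁ : IsTransferFunction T β B₁ C G₁
  transfer₂ : IsTransferFunction T β B₂ C G₂
  bounded₁ : BoundedOnHalfPlane T G₁
  bounded₂ : BoundedOnHalfPlane T G₂
  inputOutput₁ : ∀ t : ℝ≥0, ∃ F, IsInputOutputMap T β B₁ C G₁ t F
  inputOutput₂ : ∀ t : ℝ≥0, ∃ F, IsInputOutputMap T β B₂ C G₂ t F

/-- `x ∈ C([0,∞);X)` and `y ∈ L²_loc(0,∞;Y)` are the state trajectory and the output of the linear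
system with initial state `x₀` and inputs `u₁`, `u₂`. -/
structure IsLinearSolution [CompleteSpace X] (x₀ : X) (u₁ : ℝ → U₁) (u₂ : ℝ → U₂) (x : ℝ → X) (y : ℝ → Y) :
    Prop where
  input₁ : L2loc u₁
  input₂ : L2loc u₂
  continuousOn : ContinuousOn x (Ici 0)
  output_mem : L2loc y
  state_eq : ∀ t : ℝ≥0, x t = T t x₀
    + inputMap T β B₁ t ((input₁ t).toLp u₁) + inputMap T β B₂ t ((input₂ t).toLp u₂)
  output_eq : ∀ t : ℝ≥0, (output_mem t).toLp y = outputMap T β C t x₀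
    + inputOutputMap T β B₁ C G₁ t ((input₁ t).toLp u₁)
    + inputOutputMap T β B₂ C G₂ t ((input₂ t).toLp u₂)

/-- `z` and `y` are a (mild) solution and output of the bilinear feedback system, that is, of the
linear system closed by the feedback law `u₂ = N(z, y)`. -/
def IsSolution [CompleteSpace X] (N : X →L[𝕜] Y →L[𝕜] U₂) (z₀ : X) (u₁ : ℝ → U₁) (z : ℝ → X) (y : ℝ → Y) : Prop :=
  IsLinearSolution T β B₁ B₂ C G₁ G₂ z₀ u₁ (fun s => N (z s) (y s)) z y

end System

/-- `e^{ω·} u`. -/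
def expWeight (𝕜 : Type*) {U : Type*} [RCLike 𝕜] [NormedAddCommGroup U] [NormedSpace 𝕜 U]
    (ω : ℝ) (u : ℝ → U) : ℝ → U :=
  fun s => ((Real.exp (ω * s) : ℝ) : 𝕜) • u s

/-- `u ∈ L²_ω(0,∞;U)`: both `u` and `e^{ω·} u` belong to `L²(0,∞;U)`. -/
def MemL2Weighted (𝕜 : Type*) {U : Type*} [RCLike 𝕜] [NormedAddCommGroup U] [NormedSpace 𝕜 U]
    (ω : ℝ) (u : ℝ → U) : Prop :=
  MemLp u 2 ((volume : Measure ℝ).restrict (Ioi 0)) ∧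
    MemLp (expWeight 𝕜 ω u) 2 ((volume : Measure ℝ).restrict (Ioi 0))

/-- `‖u‖_{L²_ω(0,∞;U)} = ‖e^{ω·} u‖_{L²(0,∞;U)}`. -/
def normL2Weighted (𝕜 : Type*) {U : Type*} [RCLike 𝕜] [NormedAddCommGroup U] [NormedSpace 𝕜 U]
    (ω : ℝ) (u : ℝ → U) : ℝ :=
  (eLpNorm (expWeight 𝕜 ω u) 2 ((volume : Measure ℝ).restrict (Ioi 0))).toReal

end BilinearFeedback

end

open BilinearFeedback

/-!
The input, output and input-output maps `Φ_t`, `Ψ_t`, `F_t` of a well-posed triple satisfy the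
composition laws of an abstract linear system (`LinearSystem`, `LinearSystem.ofWellPosed`): running
the system for the time `t + s` amounts to running it for the time `t` and restarting it, with the
state reached and the remaining input, for the time `s`. For the input-output maps, which are known
explicitly only on regular inputs, this is causality and time invariance. It is checked on the dense
set of `C¹` inputs with compact support in `(0,t)`: such an input has ended before the time `t`, so
that the state at time `t` lies in the domain of the generator and the later output is that of the
free evolution.

From there on only the composition laws are used. If `‖T(t)‖ ≤ M e^{-λt}` and `ω < λ`, choose a step
length `h` with `e^{ωh} ‖T(h)‖ ≤ 1/2`. In the weighted energy balance over one step the contribution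
of the initial state to the final state is then absorbed, and induction over the steps gives
`e^{2ωt} ‖z(t)‖² + ∫₀ᵗ e^{2ωs} ‖y(s)‖² ds ≤ d² (‖z₀‖² + ∫₀ᵗ e^{2ωs} ‖u(s)‖² ds)`
with `d` independent of `t` (`LinearSystem.exists_totalEnergy_le`, `LinearSystem.HasGain`).

Existence. In the weighted norms the bilinear map satisfies
`‖N(z,y)‖_{L²_ω} ≤ ‖N‖ sup‖z‖ ‖y‖_{L²_ω}`. Hence the map which sends `v ∈ L²_ω(0,∞;U₂)` to
`N(z₁ + z₂, y₁ + y₂)`, where `(z₁,y₁)` is the trajectory of `(z₀,u₁)` and `(z₂,y₂)` that of `(0,v)`,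
is a contraction of the ball of radius `ε` if `ε` is small (`LinearSystem.HasGain.exists_feedback`).
Its fixed point gives the solution, and the weighted estimate of its state is the exponential decay.

Uniqueness holds among all solutions `(z',y')`, without a smallness condition on them. The
difference of two solutions is the trajectory of `(0, N(z',y') - N(z,y))`, and
`N(z',y') - N(z,y) = N(z'-z, y') + N(z, y'-y)`. In the second term the coefficient `z` is small, and
in the first one the square of the coefficient `y'` is integrable, so that its integral is small on
short intervals; the energy of the difference vanishes on one short interval after the other
(`LinearSystem.HasGain.energy_eq_zero`).
-/

noncomputable section

namespace BilinearFeedback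

/-! ### Restriction, translation and extension by zero on `L²(0,t;E)` -/

section Window

variable {E : Type*} [NormedAddCommGroup E]

theorem memLp_indicator_coe {t : ℝ≥0} (v : L2 t E) :
    MemLp ((Ioc 0 (t : ℝ)).indicator v) 2 (volume : Measure ℝ) :=
  (memLp_indicator_iff_restrict measurableSet_Ioc).2 (Lp.memLp v)

theorem memLp_indicator_translate {t : ℝ≥0} {u : ℝ → E}
    (hu : MemLp u 2 ((volume : Measure ℝ).restrict (Ioc 0 (t : ℝ)))) (a : ℝ) (S : Set ℝ) :
    MemLp (fun σ => (Ioc 0 (t : ℝ)).indicator u (σ + a)) 2 ((volume : Measure ℝ).restrict S) :=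
  (((memLp_indicator_iff_restrict measurableSet_Ioc).2 hu).comp_measurePreserving
    (measurePreserving_add_right volume a)).restrict S

theorem indicator_translate_congr {t : ℝ≥0} {u v : ℝ → E}
    (h : u =ᵐ[volume.restrict (Ioc 0 (t : ℝ))] v) (a : ℝ) :
    (fun σ => (Ioc 0 (t : ℝ)).indicator u (σ + a))
      =ᵐ[volume] fun σ => (Ioc 0 (t : ℝ)).indicator v (σ + a) := by
  have h1 : (Ioc 0 (t : ℝ)).indicator u =ᵐ[volume] (Ioc 0 (t : ℝ)).indicator v :=
    (ae_eq_restrict_iff_indicator_ae_eq measurableSet_Ioc).1 h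
  exact (measurePreserving_add_right volume a).quasiMeasurePreserving.ae_eq_comp h1

theorem eLpNorm_indicator_translate_le (a : ℝ) (t s : ℝ≥0) (v : L2 t E) :
    eLpNorm (fun σ => (Ioc 0 (t : ℝ)).indicator v (σ + a)) 2
      ((volume : Measure ℝ).restrict (Ioc 0 (s : ℝ)))
      ≤ eLpNorm v 2 ((volume : Measure ℝ).restrict (Ioc 0 (t : ℝ))) := by
  have h := eLpNorm_comp_measurePreserving (p := 2) (memLp_indicator_coe v).1
    (measurePreserving_add_right volume a)
  rw [eLpNorm_indicator_eq_eLpNorm_restrict measurableSet_Ioc] at h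
  exact (eLpNorm_mono_measure _ Measure.restrict_le_self).trans h.le

variable (𝕜 : Type*) [RCLike 𝕜] [NormedSpace 𝕜 E]

/-- The operator `L²(0,t;E) → L²(0,s;E)` which extends a function by zero to `ℝ`, translates it to
the left by `a` and restricts the result to `(0,s]`. -/
def window (a : ℝ) (t s : ℝ≥0) : L2 t E →L[𝕜] L2 s E :=
  LinearMap.mkContinuous
    { toFun := fun v => (memLp_indicator_translate (Lp.memLp v) a (Ioc 0 (s : ℝ))).toLp _
      map_add' := fun v w => by
        rw [← MemLp.toLp_add]
        refine MemLp.toLp_congr _ _ (ae_restrict_of_ae ?_)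
        filter_upwards [indicator_translate_congr (Lp.coeFn_add v w) a] with σ h
        rw [h]
        exact congrFun (indicator_add _ _ _) _
      map_smul' := fun c v => by
        rw [RingHom.id_apply, ← MemLp.toLp_const_smul]
        refine MemLp.toLp_congr _ _ (ae_restrict_of_ae ?_)
        filter_upwards [indicator_translate_congr (Lp.coeFn_smul c v) a] with σ h
        rw [h]
        exact congrFun (indicator_const_smul _ _ _) _ }
    1 fun v => by
      rw [one_mul]
      exact (Lp.norm_toLp _ (memLp_indicator_translate (Lp.memLp v) a _)).trans_le
        (ENNReal.toReal_mono (Lp.eLpNorm_ne_top v) (eLpNorm_indicator_translate_le a t s v))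

variable {𝕜}

theorem window_toLp (a : ℝ) {t s : ℝ≥0} {u : ℝ → E}
    (hu : MemLp u 2 ((volume : Measure ℝ).restrict (Ioc 0 (t : ℝ)))) :
    window 𝕜 a t s (hu.toLp u) = (memLp_indicator_translate hu a (Ioc 0 (s : ℝ))).toLp _ :=
  MemLp.toLp_congr (memLp_indicator_translate (Lp.memLp _) a _)
    (memLp_indicator_translate hu a _) (ae_restrict_of_ae (indicator_translate_congr hu.coeFn_toLp a))

theorem coeFn_window (a : ℝ) (t s : ℝ≥0) (v : L2 t E) :
    window 𝕜 a t s v =ᵐ[volume.restrict (Ioc 0 (s : ℝ))]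
      fun σ => (Ioc 0 (t : ℝ)).indicator v (σ + a) :=
  (memLp_indicator_translate (Lp.memLp v) a (Ioc 0 (s : ℝ))).coeFn_toLp

theorem window_eq_toLp (a : ℝ) {t s : ℝ≥0} {u w : ℝ → E}
    (hu : MemLp u 2 ((volume : Measure ℝ).restrict (Ioc 0 (t : ℝ))))
    (hw : MemLp w 2 ((volume : Measure ℝ).restrict (Ioc 0 (s : ℝ))))
    (h : ∀ σ ∈ Ioc 0 (s : ℝ), (Ioc 0 (t : ℝ)).indicator u (σ + a) = w σ) :
    window 𝕜 a t s (hu.toLp u) = hw.toLp w := by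
  rw [window_toLp]
  exact MemLp.toLp_congr _ _ (ae_restrict_of_forall_mem measurableSet_Ioc h)

theorem norm_window_le (a : ℝ) (t s : ℝ≥0) (v : L2 t E) : ‖window 𝕜 a t s v‖ ≤ ‖v‖ := by
  refine (ContinuousLinearMap.le_of_opNorm_le _
    (LinearMap.mkContinuous_norm_le _ zero_le_one _) v).trans ?_
  rw [one_mul]

variable (𝕜) in
/-- The restriction `L²(0,t+s;E) → L²(0,t;E)`. -/
def head (t s : ℝ≥0) : L2 (t + s) E →L[𝕜] L2 t E := window 𝕜 0 (t + s) t

variable (𝕜) in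
/-- The operator `L²(0,t+s;E) → L²(0,s;E)`, `v ↦ v(t + ·)`. -/
def tail (t s : ℝ≥0) : L2 (t + s) E →L[𝕜] L2 s E := window 𝕜 t (t + s) s

variable (𝕜) in
/-- Extension by zero `L²(0,t;E) → L²(0,t+s;E)`. -/
def padRight (t s : ℝ≥0) : L2 t E →L[𝕜] L2 (t + s) E := window 𝕜 0 t (t + s)

variable (𝕜) in
/-- The operator `L²(0,s;E) → L²(0,t+s;E)` which puts a function to the interval `(t,t+s]`. -/
def padLeft (t s : ℝ≥0) : L2 s E →L[𝕜] L2 (t + s) E := window 𝕜 (-t) s (t + s)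

theorem coeFn_head (t s : ℝ≥0) (v : L2 (t + s) E) :
    head 𝕜 t s v =ᵐ[volume.restrict (Ioc 0 (t : ℝ))] v := by
  filter_upwards [coeFn_window (𝕜 := 𝕜) 0 (t + s) t v, ae_restrict_mem measurableSet_Ioc] with σ h hσ
  rw [head, h, add_zero, indicator_of_mem]
  exact ⟨hσ.1, hσ.2.trans (by simp)⟩

theorem coeFn_tail (t s : ℝ≥0) (v : L2 (t + s) E) :
    tail 𝕜 t s v =ᵐ[volume.restrict (Ioc 0 (s : ℝ))] fun σ => v (t + σ) := by
  filter_upwards [coeFn_window (𝕜 := 𝕜) t (t + s) s v, ae_restrict_mem measurableSet_Ioc] with σ h hσ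
  rw [tail, h, add_comm σ, indicator_of_mem]
  exact ⟨add_pos_of_nonneg_of_pos t.2 hσ.1, by push_cast; linarith [hσ.2]⟩

theorem head_toLp {t s : ℝ≥0} {u : ℝ → E}
    (hu : MemLp u 2 ((volume : Measure ℝ).restrict (Ioc 0 ((t + s : ℝ≥0) : ℝ))))
    (hu' : MemLp u 2 ((volume : Measure ℝ).restrict (Ioc 0 (t : ℝ)))) :
    head 𝕜 t s (hu.toLp u) = hu'.toLp u := by
  refine window_eq_toLp _ _ _ fun σ hσ => ?_
  rw [add_zero, indicator_of_mem]
  exact ⟨hσ.1, hσ.2.trans (by simp)⟩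

theorem head_padRight (t s : ℝ≥0) (v : L2 t E) : head 𝕜 t s (padRight 𝕜 t s v) = v := by
  conv_rhs => rw [← Lp.toLp_coeFn v (Lp.memLp v)]
  refine MemLp.toLp_congr (memLp_indicator_translate (Lp.memLp _) _ _) (Lp.memLp v) ?_
  have h := indicator_translate_congr (coeFn_window (𝕜 := 𝕜) 0 t (t + s) v) 0
  filter_upwards [ae_restrict_of_ae h, ae_restrict_mem measurableSet_Ioc] with σ h hσ
  simp only [add_zero] at h ⊢
  rw [padRight, h, indicator_of_mem, indicator_of_mem hσ]
  exact ⟨hσ.1, hσ.2.trans (by simp)⟩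

theorem tail_padRight (t s : ℝ≥0) (v : L2 t E) : tail 𝕜 t s (padRight 𝕜 t s v) = 0 := by
  rw [← Lp.toLp_coeFn (0 : L2 s E) (Lp.memLp 0)]
  refine MemLp.toLp_congr (memLp_indicator_translate (Lp.memLp _) _ _) (Lp.memLp 0) ?_
  have h := indicator_translate_congr (coeFn_window (𝕜 := 𝕜) 0 t (t + s) v) t
  filter_upwards [ae_restrict_of_ae h, ae_restrict_mem measurableSet_Ioc,
    Lp.coeFn_zero E 2 ((volume : Measure ℝ).restrict (Ioc 0 (s : ℝ)))] with σ h hσ h0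
  simp only [add_zero] at h
  rw [padRight, h, h0]
  refine indicator_apply_eq_zero.2 fun _ => indicator_of_notMem ?_ _
  exact fun h' => by linarith [h'.2, hσ.1]

theorem head_padLeft (t s : ℝ≥0) (v : L2 s E) : head 𝕜 t s (padLeft 𝕜 t s v) = 0 := by
  rw [← Lp.toLp_coeFn (0 : L2 t E) (Lp.memLp 0)]
  refine MemLp.toLp_congr (memLp_indicator_translate (Lp.memLp _) _ _) (Lp.memLp 0) ?_
  have h := indicator_translate_congr (coeFn_window (𝕜 := 𝕜) (-t) s (t + s) v) 0
  filter_upwards [ae_restrict_of_ae h, ae_restrict_mem measurableSet_Ioc,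
    Lp.coeFn_zero E 2 ((volume : Measure ℝ).restrict (Ioc 0 (t : ℝ)))] with σ h hσ h0
  simp only [add_zero] at h ⊢
  rw [padLeft, h, h0]
  refine indicator_apply_eq_zero.2 fun _ => indicator_of_notMem ?_ _
  exact fun h' => by linarith [h'.1, hσ.2]

theorem tail_padLeft (t s : ℝ≥0) (v : L2 s E) : tail 𝕜 t s (padLeft 𝕜 t s v) = v := by
  conv_rhs => rw [← Lp.toLp_coeFn v (Lp.memLp v)]
  refine MemLp.toLp_congr (memLp_indicator_translate (Lp.memLp _) _ _) (Lp.memLp v) ?_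
  have h := indicator_translate_congr (coeFn_window (𝕜 := 𝕜) (-t) s (t + s) v) t
  filter_upwards [ae_restrict_of_ae h, ae_restrict_mem measurableSet_Ioc] with σ h hσ
  rw [padLeft, h, indicator_of_mem, add_neg_cancel_right, indicator_of_mem hσ]
  exact ⟨by linarith [hσ.1, t.2], by push_cast; linarith [hσ.2]⟩

/-- The interval `(0,t+s]` splits into `(0,t]` and the translate of `(0,s]` by `t`. -/
theorem ae_restrict_Ioc_add {t s : ℝ≥0} {P : ℝ → Prop}
    (h₁ : ∀ᵐ σ ∂(volume.restrict (Ioc 0 (t : ℝ))), P σ)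
    (h₂ : ∀ᵐ σ ∂(volume.restrict (Ioc 0 (s : ℝ))), P ((t : ℝ) + σ)) :
    ∀ᵐ σ ∂(volume.restrict (Ioc 0 ((t + s : ℝ≥0) : ℝ))), P σ := by
  have h₂' : ∀ᵐ (σ : ℝ) ∂(volume : Measure ℝ), σ - t ∈ Ioc 0 (s : ℝ) → P (t + (σ - t)) :=
    (measurePreserving_sub_right volume (t : ℝ)).quasiMeasurePreserving.ae
      ((ae_restrict_iff' measurableSet_Ioc).1 h₂)
  rw [ae_restrict_iff' measurableSet_Ioc] at h₁ ⊢
  filter_upwards [h₁, h₂'] with σ h₁ h₂ hσ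
  by_cases hσt : σ ≤ t
  · exact h₁ ⟨hσ.1, hσt⟩
  · have := h₂ ⟨by linarith, by have := hσ.2; push_cast at this; linarith⟩
    rwa [add_sub_cancel] at this

theorem ae_restrict_Ioc_shift {t s : ℝ≥0} {P : ℝ → Prop}
    (h : ∀ᵐ σ ∂(volume.restrict (Ioc 0 ((t + s : ℝ≥0) : ℝ))), P σ) :
    ∀ᵐ σ ∂(volume.restrict (Ioc 0 (s : ℝ))), P ((t : ℝ) + σ) := by
  rw [ae_restrict_iff' measurableSet_Ioc] at h ⊢
  have h' := (measurePreserving_add_left volume (t : ℝ)).quasiMeasurePreserving.ae h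
  filter_upwards [h'] with σ h hσ
  exact h ⟨by linarith [hσ.1, t.2], by push_cast; linarith [hσ.2]⟩

theorem ae_restrict_Ioc_left {t s : ℝ≥0} {P : ℝ → Prop}
    (h : ∀ᵐ σ ∂(volume.restrict (Ioc 0 ((t + s : ℝ≥0) : ℝ))), P σ) :
    ∀ᵐ σ ∂(volume.restrict (Ioc 0 (t : ℝ))), P σ :=
  ae_restrict_of_ae_restrict_of_subset (Ioc_subset_Ioc_right (by simp)) h

variable (𝕜) in
/-- An element of `L²(0,t+s;E)` is determined by its restrictions to `(0,t]` and `(t,t+s]`. -/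
theorem ext_head_tail {t s : ℝ≥0} {v w : L2 (t + s) E} (h₁ : head 𝕜 t s v = head 𝕜 t s w)
    (h₂ : tail 𝕜 t s v = tail 𝕜 t s w) : v = w := by
  refine Lp.ext (ae_restrict_Ioc_add ?_ ?_)
  · filter_upwards [coeFn_head (𝕜 := 𝕜) t s v, coeFn_head (𝕜 := 𝕜) t s w] with σ h h'
    rw [← h, ← h', h₁]
  · filter_upwards [coeFn_tail (𝕜 := 𝕜) t s v, coeFn_tail (𝕜 := 𝕜) t s w] with σ h h'
    rw [← h, ← h', h₂]

theorem padRight_head_add_padLeft_tail (t s : ℝ≥0) (v : L2 (t + s) E) :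
    padRight 𝕜 t s (head 𝕜 t s v) + padLeft 𝕜 t s (tail 𝕜 t s v) = v :=
  ext_head_tail 𝕜 (by rw [map_add, head_padRight, head_padLeft, add_zero])
    (by rw [map_add, tail_padRight, tail_padLeft, zero_add])

end Window

/-! ### Density of test functions in `L²(0,t;E)` -/

section Density

variable {E : Type*} [NormedAddCommGroup E] [NormedSpace ℝ E]

/-- Truncation to `[δ,t-δ]`, smooth approximation and multiplication by a smooth cutoff function. -/
theorem exists_contDiff_eLpNorm_sub_le {t : ℝ≥0} {f : ℝ → E}
    (hf : MemLp f 2 ((volume : Measure ℝ).restrict (Ioc 0 (t : ℝ)))) {ε : ℝ} (hε : 0 < ε) :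
    ∃ g : ℝ → E, ContDiff ℝ 1 g ∧ HasCompactSupport g ∧ tsupport g ⊆ Ioo 0 (t : ℝ) ∧
      eLpNorm (f - g) 2 ((volume : Measure ℝ).restrict (Ioc 0 (t : ℝ))) ≤ ENNReal.ofReal ε := by
  rcases eq_or_ne t 0 with rfl | ht
  · exact ⟨0, contDiff_const, HasCompactSupport.zero, by simp, by simp⟩
  have ht : (0 : ℝ) < t := by positivity
  set μ := (volume : Measure ℝ).restrict (Ioc 0 (t : ℝ)) with hμ
  obtain ⟨δ, hδ, hsmall⟩ := hf.eLpNorm_indicator_le one_le_two (by simp) (half_pos hε)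
  set η := min (δ / 2) (t / 4) with hη
  have hη0 : 0 < η := by positivity
  have hη1 : η ≤ δ / 2 := min_le_left _ _
  have hη2 : η ≤ t / 4 := min_le_right _ _
  set A := Icc η (t - η) with hA
  have hfA : MemLp (A.indicator f) 2 μ := hf.indicator measurableSet_Icc
  obtain ⟨g₀, hg₀c, hg₀, hg₀ε⟩ := hfA.exist_eLpNorm_sub_le (by simp) one_le_two (half_pos hε)
  let χ : ContDiffBump ((t : ℝ) / 2) := ⟨t / 2 - η, t / 2 - η / 2, by linarith, by linarith⟩
  have hχs : tsupport (fun s => χ s) ⊆ Ioo 0 (t : ℝ) := by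
    rw [χ.tsupport_eq, Real.closedBall_eq_Icc]
    intro s hs
    simp only [mem_Icc, χ] at hs
    exact ⟨by linarith [hs.1], by linarith [hs.2]⟩
  have hχ1 : ∀ s ∈ A, χ s = 1 := fun s hs => χ.one_of_mem_closedBall (by
    rw [Real.closedBall_eq_Icc]
    exact ⟨by simp only [χ]; linarith [hs.1], by simp only [χ]; linarith [hs.2]⟩)
  have hsupp : tsupport (fun s => χ s • g₀ s) ⊆ Ioo 0 (t : ℝ) :=
    (tsupport_smul_subset_left (fun s => χ s) g₀).trans hχs
  refine ⟨fun s => χ s • g₀ s, χ.contDiff.smul (hg₀.of_le (by norm_cast)),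
    hg₀c.smul_left, hsupp, ?_⟩
  have hsplit : (f - fun s => χ s • g₀ s)
      = Aᶜ.indicator f + fun s => χ s • (A.indicator f - g₀) s := by
    ext s
    by_cases hs : s ∈ A
    · simp [hs, hχ1 s hs, smul_sub]
    · simp [hs, sub_eq_add_neg]
  have hm : AEStronglyMeasurable (A.indicator f - g₀) μ :=
    hfA.1.sub hg₀.continuous.aestronglyMeasurable
  rw [hsplit]
  refine (eLpNorm_add_le (hf.1.indicator measurableSet_Icc.compl)
    (χ.continuous.aestronglyMeasurable.smul hm) one_le_two).trans ?_
  rw [← add_halves ε, ENNReal.ofReal_add (by positivity) (by positivity)]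
  refine add_le_add (hsmall _ measurableSet_Icc.compl ?_) ((eLpNorm_mono fun s => ?_).trans hg₀ε)
  · rw [hμ, Measure.restrict_apply measurableSet_Icc.compl]
    have : Aᶜ ∩ Ioc 0 (t : ℝ) ⊆ Ioo 0 η ∪ Ioc (t - η) t := by
      rintro s ⟨hs, hs'⟩
      by_cases h : s < η
      · exact Or.inl ⟨hs'.1, h⟩
      · refine Or.inr ⟨not_le.1 fun h' => hs ⟨not_lt.1 h, h'⟩, hs'.2⟩
    refine (measure_mono this).trans ((measure_union_le _ _).trans ?_)
    rw [Real.volume_Ioo, Real.volume_Ioc, ← ENNReal.ofReal_add (by linarith) (by linarith)]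
    exact ENNReal.ofReal_le_ofReal (by linarith)
  · rw [Pi.smul_apply', norm_smul, Real.norm_of_nonneg χ.nonneg]
    exact mul_le_of_le_one_left (norm_nonneg _) χ.le_one

end Density

section

variable {𝕜 X U : Type*} [RCLike 𝕜]
  [NormedAddCommGroup X] [NormedSpace 𝕜 X]
  [NormedAddCommGroup U] [NormedSpace 𝕜 U]

/-! ### The extrapolated semigroup -/

section Extrapolated

variable (T : C0Semigroup 𝕜 X) (β : T.resolventSet)

theorem norm_Tm1_apply_le (t : ℝ≥0) (x : T.Xm1 β) : ‖T.Tm1 β t x‖ ≤ ‖T t‖ * ‖x‖ := by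
  refine LinearMap.norm_extendOfNorm_apply_le (T.denseRange_emb β) _ (fun x => ?_) x
  simp only [LinearMap.comp_apply, ContinuousLinearMap.coe_coe, T.norm_emb β]
  rw [T.resolvent_comm β.2]
  exact (T t).le_opNorm _

theorem Tm1_add (s t : ℝ≥0) (x : T.Xm1 β) : T.Tm1 β (s + t) x = T.Tm1 β s (T.Tm1 β t x) := by
  have : (T.Tm1 β (s + t) : T.Xm1 β → T.Xm1 β) = fun x => T.Tm1 β s (T.Tm1 β t x) := by
    refine (T.denseRange_emb β).equalizer (T.Tm1 β (s + t)).continuous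
      ((T.Tm1 β s).continuous.comp (T.Tm1 β t).continuous) (funext fun x => ?_)
    simp [T.Tm1_emb, T.map_add]
  exact congrFun this x

theorem exists_lipschitzWith_emb : ∃ c : ℝ≥0, LipschitzWith c (T.emb β) :=
  ⟨‖T.resolvent (β : 𝕜)‖₊, AddMonoidHomClass.lipschitz_of_bound_nnnorm (T.emb β) _ fun x => by
    rw [← NNReal.coe_le_coe, coe_nnnorm, T.norm_emb β]
    exact (T.resolvent (β : 𝕜)).le_opNorm x⟩

theorem continuous_emb : Continuous (T.emb β) := (exists_lipschitzWith_emb T β).choose_spec.continuous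

variable {T}

/-- A bounded semigroup acts jointly continuously on the extrapolation space. -/
theorem continuous_Tm1 {M : ℝ} (hM : ∀ t, ‖T t‖ ≤ M) :
    Continuous fun p : T.Xm1 β × ℝ≥0 => T.Tm1 β p.2 p.1 := by
  refine continuous_prod_of_dense_continuous_lipschitzWith _ M.toNNReal (T.denseRange_emb β) ?_ ?_
  · rintro _ ⟨x, rfl⟩
    simp only [T.Tm1_emb β]
    exact (continuous_emb T β).comp (T.continuous_orbit x)
  · intro t
    refine AddMonoidHomClass.lipschitz_of_bound_nnnorm (T.Tm1 β t) _ fun x => ?_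
    rw [← NNReal.coe_le_coe, coe_nnnorm, NNReal.coe_mul, coe_nnnorm]
    refine (norm_Tm1_apply_le T β t x).trans ?_
    gcongr
    exact (hM t).trans (Real.le_coe_toNNReal M)

end Extrapolated

/-! ### Input maps -/

section Input

variable {T : C0Semigroup 𝕜 X} {β : T.resolventSet} {B : U →L[𝕜] T.Xm1 β}

theorem inputIntegral_congr {u v : ℝ → U} {t : ℝ} (h : u =ᵐ[volume.restrict (Ioc 0 t)] v) :
    inputIntegral T β B u t = inputIntegral T β B v t := by
  refine integral_congr_ae ?_
  filter_upwards [h] with s hs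
  rw [hs]

theorem inputIntegral_eq_zero {u : ℝ → U} {t : ℝ} (h : u =ᵐ[volume.restrict (Ioc 0 t)] 0) :
    inputIntegral T β B u t = 0 := by
  rw [inputIntegral_congr h]
  simp [inputIntegral]

theorem aestronglyMeasurable_comp_toNNReal_sub {E : Type*} [NormedAddCommGroup E]
    {S : ℝ≥0 → E → E} (hS : Continuous fun p : E × ℝ≥0 => S p.2 p.1) {w : ℝ → E} {μ : Measure ℝ}
    (hw : AEStronglyMeasurable w μ) (t : ℝ) :
    AEStronglyMeasurable (fun s => S (t - s).toNNReal (w s)) μ := by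
  have hc : Continuous fun s : ℝ => (t - s).toNNReal :=
    continuous_real_toNNReal.comp (continuous_const.sub continuous_id)
  have hp : AEStronglyMeasurable (fun s => (w s, (t - s).toNNReal)) μ :=
    hw.prodMk hc.aestronglyMeasurable
  exact hS.comp_aestronglyMeasurable hp

theorem integrable_inputIntegrand {M : ℝ} (hM : ∀ t, ‖T t‖ ≤ M) {u : ℝ → U} {r : ℝ}
    (hu : MemLp u 2 ((volume : Measure ℝ).restrict (Ioc 0 r))) (t : ℝ) :
    IntegrableOn (fun s => T.Tm1 β (t - s).toNNReal (B (u s))) (Ioc 0 r) := by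
  have hBu : Integrable (fun s => B (u s)) ((volume : Measure ℝ).restrict (Ioc 0 r)) :=
    B.integrable_comp (hu.integrable one_le_two)
  have hle : ∀ s, ‖T.Tm1 β (t - s).toNNReal (B (u s))‖ ≤ M * ‖B (u s)‖ := fun s =>
    (norm_Tm1_apply_le T β _ _).trans (mul_le_mul_of_nonneg_right (hM _) (norm_nonneg _))
  exact Integrable.mono' (hBu.norm.const_mul M)
    (aestronglyMeasurable_comp_toNNReal_sub (S := fun t x => T.Tm1 β t x)
      (continuous_Tm1 β hM) hBu.1 t) (ae_of_all _ hle)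

/-- The state reached at time `t + s` is the one reached at time `t`, evolved freely over a time
`s`, plus the effect of the input after time `t`. -/
theorem inputIntegral_add {M : ℝ} (hM : ∀ t, ‖T t‖ ≤ M) {u : ℝ → U} {t s : ℝ≥0}
    (hu : MemLp u 2 ((volume : Measure ℝ).restrict (Ioc 0 ((t + s : ℝ≥0) : ℝ)))) :
    inputIntegral T β B u ((t + s : ℝ≥0) : ℝ) = T.Tm1 β s (inputIntegral T β B u t)
      + inputIntegral T β B (fun σ => u (t + σ)) s := by
  have hsub : Ioc 0 (t : ℝ) ⊆ Ioc 0 ((t + s : ℝ≥0) : ℝ) := Ioc_subset_Ioc_right (by simp)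
  have hun : Ioc 0 ((t + s : ℝ≥0) : ℝ) = Ioc 0 (t : ℝ) ∪ Ioc (t : ℝ) ((t + s : ℝ≥0) : ℝ) :=
    (Ioc_union_Ioc_eq_Ioc t.2 (by simp)).symm
  have hi := integrable_inputIntegrand (B := B) hM hu ((t + s : ℝ≥0) : ℝ)
  have hi' := integrable_inputIntegrand (B := B) hM
    (hu.mono_measure (Measure.restrict_mono hsub le_rfl)) (t : ℝ)
  rw [inputIntegral, hun, setIntegral_union (Ioc_disjoint_Ioc_of_le le_rfl) measurableSet_Ioc
    (hi.mono_set hsub) (hi.mono_set (hun ▸ subset_union_right))]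
  congr 1
  · rw [inputIntegral, ← ContinuousLinearMap.integral_comp_comm _ hi']
    refine setIntegral_congr_fun measurableSet_Ioc fun r hr => ?_
    rw [← Tm1_add]
    congr 2
    have h₁ : (0 : ℝ) ≤ t - r := by linarith [hr.2]
    rw [NNReal.coe_add, add_sub_right_comm, add_comm ((t : ℝ) - r),
      Real.toNNReal_add s.coe_nonneg h₁, Real.toNNReal_coe]
  · rw [inputIntegral, ← (measurePreserving_add_left volume (t : ℝ)).setIntegral_preimage_emb
      (measurableEmbedding_addLeft (t : ℝ))]
    have hpre : (fun σ => (t : ℝ) + σ) ⁻¹' Ioc (t : ℝ) ((t + s : ℝ≥0) : ℝ) = Ioc 0 (s : ℝ) := by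
      ext σ
      simp
    rw [hpre]
    refine setIntegral_congr_fun measurableSet_Ioc fun r hr => ?_
    congr 3
    push_cast
    ring

theorem IsInputMap.unique {t : ℝ≥0} {Φ Φ' : L2 t U →L[𝕜] X} (h : IsInputMap T β B t Φ)
    (h' : IsInputMap T β B t Φ') : Φ = Φ' :=
  ContinuousLinearMap.ext fun u => T.emb_injective β ((h u).trans (h' u).symm)

theorem inputIntegral_coe_add {M : ℝ} (hM : ∀ t, ‖T t‖ ≤ M) {t s : ℝ≥0} (v : L2 (t + s) U) :
    inputIntegral T β B v ((t + s : ℝ≥0) : ℝ)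
      = T.Tm1 β s (inputIntegral T β B (head 𝕜 t s v) t)
        + inputIntegral T β B (tail 𝕜 t s v) s := by
  rw [inputIntegral_add hM (Lp.memLp v), inputIntegral_congr (coeFn_head t s v),
    inputIntegral_congr (coeFn_tail t s v)]

theorem IsInputMap.add {M : ℝ} (hM : ∀ t, ‖T t‖ ≤ M) {t s : ℝ≥0} {Φ : L2 t U →L[𝕜] X}
    {Φ' : L2 s U →L[𝕜] X} (h : IsInputMap T β B t Φ) (h' : IsInputMap T β B s Φ') :
    IsInputMap T β B (t + s)
      ((T s).comp (Φ.comp (head 𝕜 t s)) + Φ'.comp (tail 𝕜 t s)) := fun v => by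
  simp only [add_apply, ContinuousLinearMap.comp_apply, map_add]
  rw [← T.Tm1_emb, h, h', inputIntegral_coe_add hM]

theorem IsInputMap.comp_padLeft {M : ℝ} (hM : ∀ t, ‖T t‖ ≤ M) {t s : ℝ≥0}
    {Φ : L2 (t + s) U →L[𝕜] X} (h : IsInputMap T β B (t + s) Φ) :
    IsInputMap T β B s (Φ.comp (padLeft 𝕜 t s)) := fun v => by
  rw [ContinuousLinearMap.comp_apply, h, inputIntegral_coe_add hM, head_padLeft, tail_padLeft,
    inputIntegral_eq_zero (Lp.coeFn_zero U 2 _), map_zero, zero_add]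

/-- Admissibility for one time implies admissibility for all times. -/
theorem AdmissibleControl.exists_isInputMap {M : ℝ} (hM : ∀ t, ‖T t‖ ≤ M)
    (h : AdmissibleControl T β B) (t : ℝ≥0) : ∃ Φ, IsInputMap T β B t Φ := by
  obtain ⟨τ, hτ, Φ, hΦ⟩ := h
  have hn : ∀ n : ℕ, ∃ Φ, IsInputMap T β B (n • τ) Φ := by
    intro n
    induction n with
    | zero =>
      rw [zero_nsmul]
      exact ⟨0, fun v => by rw [zero_apply, map_zero]; simp [inputIntegral]⟩
    | succ n ih =>
      obtain ⟨Φ', hΦ'⟩ := ih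
      rw [succ_nsmul]
      exact ⟨_, hΦ'.add hM hΦ⟩
  obtain ⟨n, hn'⟩ := Archimedean.arch t hτ
  obtain ⟨s, hs⟩ := exists_add_of_le hn'
  have hn'' := hn n
  rw [hs, add_comm] at hn''
  obtain ⟨Φ', hΦ'⟩ := hn''
  exact ⟨_, hΦ'.comp_padLeft hM⟩

theorem isInputMap_inputMap {t : ℝ≥0} (h : ∃ Φ, IsInputMap T β B t Φ) :
    IsInputMap T β B t (inputMap T β B t) := by
  rw [inputMap, dif_pos h]
  exact h.choose_spec

end Input

end

section

variable {𝕜 X Y : Type*} [RCLike 𝕜]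
  [NormedAddCommGroup X] [NormedSpace 𝕜 X]
  [NormedAddCommGroup Y] [NormedSpace 𝕜 Y]

/-! ### Density of the domain of the generator -/

section Domain

variable {T : C0Semigroup 𝕜 X}

theorem semigroup_add_apply (s t : ℝ≥0) (x : X) : T (s + t) x = T s (T t x) := by
  rw [T.map_add, ContinuousLinearMap.comp_apply]

theorem semigroup_zero_apply (x : X) : T 0 x = x := by
  rw [T.map_zero, ContinuousLinearMap.id_apply]

/-- The integrals `∫₀ʰ T(s)x ds` belong to the domain of the generator, and their means converge to
`x` as `h → 0`. -/
theorem dense_generator_domain [CompleteSpace X] : Dense (T.generator.domain : Set X) := by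
  let _ : NormedSpace ℝ X := NormedSpace.restrictScalars ℝ 𝕜 X
  intro x
  set g : ℝ → X := fun s => T s.toNNReal x with hg
  have hgc : Continuous g := (T.continuous_orbit x).comp continuous_real_toNNReal
  set G : ℝ → X := fun t => ∫ s in (0 : ℝ)..t, g s with hG
  have hGd : ∀ t, HasDerivAt G (g t) t := fun t =>
    intervalIntegral.integral_hasDerivAt_right (hgc.intervalIntegrable _ _)
      hgc.aestronglyMeasurable.stronglyMeasurableAtFilter hgc.continuousAt
  have hshift : ∀ h r : ℝ≥0, T r (G h) = G (h + r) - G r := by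
    intro h r
    have h1 : T r (G h) = ∫ s in (0 : ℝ)..h, T r (g s) :=
      ((T r).intervalIntegral_comp_comm (hgc.intervalIntegrable _ _)).symm
    have h2 : ∫ s in (0 : ℝ)..h, T r (g s) = ∫ s in (0 : ℝ)..h, g (r + s) := by
      refine intervalIntegral.integral_congr fun s hs => ?_
      rw [uIcc_of_le h.coe_nonneg] at hs
      simp only [hg]
      rw [← semigroup_add_apply, Real.toNNReal_add r.coe_nonneg hs.1, Real.toNNReal_coe]
    rw [h1, h2, intervalIntegral.integral_comp_add_left, add_zero, add_comm (r : ℝ),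
      ← intervalIntegral.integral_interval_sub_left (hgc.intervalIntegrable _ _)
        (hgc.intervalIntegrable _ _)]
  have hcoe : Tendsto (fun h : ℝ≥0 => (h : ℝ)) (𝓝[>] 0) (𝓝[≠] 0) := by
    refine tendsto_nhdsWithin_iff.2 ⟨?_, ?_⟩
    · exact (NNReal.continuous_coe.tendsto 0).mono_left nhdsWithin_le_nhds
    · filter_upwards [self_mem_nhdsWithin] with h hh
      exact (NNReal.coe_pos.2 hh).ne'
  have hslope : ∀ t, Tendsto (fun h : ℝ≥0 => (h : ℝ)⁻¹ • (G (t + h) - G t)) (𝓝[>] 0) (𝓝 (g t)) :=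
    fun t => ((hasDerivAt_iff_tendsto_slope_zero).1 (hGd t)).comp hcoe
  have hG0 : G 0 = 0 := intervalIntegral.integral_same
  have hsmul : ∀ (r : ℝ) (y : X), r • y = (r : 𝕜) • y := fun r y => (RCLike.real_smul_eq_coe_smul r y)
  have hdom : ∀ h : ℝ≥0, G h ∈ T.generator.domain := by
    intro h
    refine ⟨g h - g 0, ((hslope h).sub (hslope 0)).congr fun r => ?_⟩
    rw [← smul_sub, hshift, hsmul, hG0, zero_add]
    congr 1
    · push_cast; rfl
    · abel
  refine mem_closure_of_tendsto (f := fun h : ℝ≥0 => (h : ℝ)⁻¹ • G h) (b := 𝓝[>] 0) ?_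
    (Eventually.of_forall fun h => ?_)
  · have := hslope 0
    simp only [hG0, zero_add, sub_zero] at this
    rwa [show g 0 = x by simp [hg, semigroup_zero_apply]] at this
  · rw [SetLike.mem_coe, hsmul]
    exact T.generator.domain.smul_mem _ (hdom h)

end Domain

/-! ### Output maps -/

section Output

open C0Semigroup

variable {T : C0Semigroup 𝕜 X} {β : T.resolventSet} {C : T.X1 β →L[𝕜] Y}

theorem incl_injective : Function.Injective (X1.incl T β) := Subtype.val_injective

theorem emb_incl_injective : Function.Injective fun x : T.X1 β => T.emb β (X1.incl T β x) :=
  (T.emb_injective β).comp incl_injective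

theorem denseRange_incl [CompleteSpace X] : DenseRange (X1.incl T β) := by
  have h : range (X1.incl T β) = (T.generator.domain : Set X) := Subtype.range_coe
  rw [DenseRange, h]
  exact dense_generator_domain

theorem incl_orbit (t : ℝ≥0) (x : T.X1 β) : X1.incl T β (X1.orbit T β t x) = T t (X1.incl T β x) :=
  rfl

theorem orbit_add (s t : ℝ≥0) (x : T.X1 β) :
    X1.orbit T β (s + t) x = X1.orbit T β s (X1.orbit T β t x) :=
  incl_injective (semigroup_add_apply s t _)

theorem ext_incl [CompleteSpace X] {F : Type*} [NormedAddCommGroup F] [NormedSpace 𝕜 F]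
    {f g : X →L[𝕜] F} (h : ∀ x : T.X1 β, f (X1.incl T β x) = g (X1.incl T β x)) : f = g :=
  DFunLike.coe_injective (denseRange_incl.equalizer f.continuous g.continuous (funext h))

theorem IsOutputMap.unique [CompleteSpace X] {t : ℝ≥0} {Ψ Ψ' : X →L[𝕜] L2 t Y}
    (h : IsOutputMap T β C t Ψ) (h' : IsOutputMap T β C t Ψ') : Ψ = Ψ' := by
  exact ext_incl (T := T) (β := β) fun x => Lp.ext ((h x).trans (h' x).symm)

theorem IsOutputMap.head {t s : ℝ≥0} {Ψ : X →L[𝕜] L2 (t + s) Y}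
    (h : IsOutputMap T β C (t + s) Ψ) : IsOutputMap T β C t ((head 𝕜 t s).comp Ψ) := fun x =>
  (coeFn_head (𝕜 := 𝕜) t s (Ψ _)).trans (ae_restrict_Ioc_left (h x))

theorem IsOutputMap.tail [CompleteSpace X] {t s : ℝ≥0} {Ψ : X →L[𝕜] L2 (t + s) Y}
    {Ψ' : X →L[𝕜] L2 s Y} (h : IsOutputMap T β C (t + s) Ψ) (h' : IsOutputMap T β C s Ψ') :
    (tail 𝕜 t s).comp Ψ = Ψ'.comp (T t) := by
  refine ext_incl (T := T) (β := β) fun x => Lp.ext ?_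
  have h₂ := h' (X1.orbit T β t x)
  filter_upwards [coeFn_tail (𝕜 := 𝕜) t s (Ψ (X1.incl T β x)), ae_restrict_Ioc_shift (h x), h₂,
    ae_restrict_mem measurableSet_Ioc] with σ h₁ h₂ h₃ hσ
  rw [incl_orbit] at h₃
  rw [ContinuousLinearMap.comp_apply, ContinuousLinearMap.comp_apply, h₁, h₂, h₃, ← orbit_add,
    Real.toNNReal_add t.coe_nonneg hσ.1.le, Real.toNNReal_coe, add_comm]

theorem IsOutputMap.add {t s : ℝ≥0} {Ψ : X →L[𝕜] L2 t Y}
    {Ψ' : X →L[𝕜] L2 s Y} (h : IsOutputMap T β C t Ψ) (h' : IsOutputMap T β C s Ψ') :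
    IsOutputMap T β C (t + s) ((padRight 𝕜 t s).comp Ψ + (padLeft 𝕜 t s).comp (Ψ'.comp (T t))) := by
  intro x
  set w := ((padRight 𝕜 t s).comp Ψ + (padLeft 𝕜 t s).comp (Ψ'.comp (T t))) (X1.incl T β x) with hw
  have hh : BilinearFeedback.head 𝕜 t s w = Ψ (X1.incl T β x) := by
    rw [hw, add_apply, _root_.map_add]
    simp only [ContinuousLinearMap.comp_apply, head_padRight, head_padLeft, add_zero]
  have ht : BilinearFeedback.tail 𝕜 t s w = Ψ' (X1.incl T β (X1.orbit T β t x)) := by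
    rw [hw, add_apply, _root_.map_add]
    simp only [ContinuousLinearMap.comp_apply, tail_padRight, tail_padLeft, zero_add, incl_orbit]
  refine ae_restrict_Ioc_add ?_ ?_
  · filter_upwards [coeFn_head (𝕜 := 𝕜) t s w, h x] with σ h₁ h₂
    rw [← h₁, hh, h₂]
  · filter_upwards [coeFn_tail (𝕜 := 𝕜) t s w, h' (X1.orbit T β t x),
      ae_restrict_mem measurableSet_Ioc] with σ h₁ h₂ hσ
    rw [← h₁, ht, h₂, ← orbit_add, Real.toNNReal_add t.coe_nonneg hσ.1.le, Real.toNNReal_coe,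
      add_comm]

/-- Admissibility for one time implies admissibility for all times. -/
theorem AdmissibleObservation.exists_isOutputMap (h : AdmissibleObservation T β C) (t : ℝ≥0) :
    ∃ Ψ, IsOutputMap T β C t Ψ := by
  obtain ⟨τ, hτ, Ψ, hΨ⟩ := h
  have hn : ∀ n : ℕ, ∃ Ψ, IsOutputMap T β C (n • τ) Ψ := by
    intro n
    induction n with
    | zero =>
      rw [zero_nsmul]
      exact ⟨0, fun x => by simp [EventuallyEq]⟩
    | succ n ih =>
      obtain ⟨Ψ', hΨ'⟩ := ih
      rw [succ_nsmul]
      exact ⟨_, hΨ'.add hΨ⟩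
  obtain ⟨n, hn'⟩ := Archimedean.arch t hτ
  obtain ⟨s, hs⟩ := exists_add_of_le hn'
  have hn'' := hn n
  rw [hs] at hn''
  obtain ⟨Ψ', hΨ'⟩ := hn''
  exact ⟨_, hΨ'.head⟩

theorem isOutputMap_outputMap {t : ℝ≥0} (h : ∃ Ψ, IsOutputMap T β C t Ψ) :
    IsOutputMap T β C t (outputMap T β C t) := by
  rw [outputMap, dif_pos h]
  exact h.choose_spec

end Output

end

/-! ### Test functions -/

section Test

variable {𝕜 U : Type*} [RCLike 𝕜] [NormedAddCommGroup U] [NormedSpace 𝕜 U]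

variable (𝕜) in
/-- `g` is a continuously differentiable function with compact support in `(0,t)`. -/
def IsTestFunction (t : ℝ≥0) (g : ℝ → U) : Prop :=
  letI : NormedSpace ℝ U := NormedSpace.restrictScalars ℝ 𝕜 U
  ContDiff ℝ 1 g ∧ HasCompactSupport g ∧ tsupport g ⊆ Ioo 0 (t : ℝ)

variable {t : ℝ≥0} {g : ℝ → U}

theorem IsTestFunction.continuous (hg : IsTestFunction 𝕜 t g) : Continuous g := by
  let _ : NormedSpace ℝ U := NormedSpace.restrictScalars ℝ 𝕜 U
  exact hg.1.continuous

theorem IsTestFunction.memLp (hg : IsTestFunction 𝕜 t g) (μ : Measure ℝ)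
    [IsFiniteMeasureOnCompacts μ] : MemLp g 2 μ :=
  hg.continuous.memLp_of_hasCompactSupport hg.2.1

theorem IsTestFunction.eq_zero (hg : IsTestFunction 𝕜 t g) {s : ℝ} (hs : s ∉ Ioo 0 (t : ℝ)) :
    g s = 0 :=
  image_eq_zero_of_notMem_tsupport fun h => hs (hg.2.2 h)

theorem IsTestFunction.w12locZero_sub [CompleteSpace U] (hg : IsTestFunction 𝕜 t g) (a : ℝ≥0) :
    W12locZero 𝕜 fun s => g (s - a) := by
  let _ : NormedSpace ℝ U := NormedSpace.restrictScalars ℝ 𝕜 U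
  have hg1 : ContDiff ℝ 1 g := hg.1
  have hd : ContDiff ℝ 1 fun s => g (s - a) := hg1.comp (contDiff_id.sub contDiff_const)
  have hc : Continuous (deriv fun s => g (s - a)) := hd.continuous_deriv le_rfl
  refine ⟨deriv fun s => g (s - a), fun τ => ?_, fun τ hτ => ?_⟩
  · have hcs : HasCompactSupport fun s => g (s - a) :=
      hg.2.1.comp_homeomorph (Homeomorph.subRight (a : ℝ))
    exact hc.memLp_of_hasCompactSupport hcs.deriv
  · have := intervalIntegral.integral_deriv_eq_sub (a := 0) (b := τ) (f := fun s => g (s - a))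
      (fun s _ => (hd.differentiable one_ne_zero).differentiableAt)
      (hc.intervalIntegrable _ _)
    rw [intervalIntegral.integral_of_le hτ] at this
    rw [this, hg.eq_zero (s := 0 - a) fun h => by linarith [h.1, a.coe_nonneg], sub_zero]

theorem IsTestFunction.w12locZero [CompleteSpace U] (hg : IsTestFunction 𝕜 t g) :
    W12locZero 𝕜 g := by
  simpa using hg.w12locZero_sub 0

theorem dense_isTestFunction (t : ℝ≥0) :
    Dense {v : L2 t U | ∃ g, ∃ hg : IsTestFunction 𝕜 t g, v = (hg.memLp _).toLp g} := by
  let _ : NormedSpace ℝ U := NormedSpace.restrictScalars ℝ 𝕜 U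
  intro v
  refine (mem_closure_iff_nhds_basis Metric.nhds_basis_closedBall).2 fun ε hε => ?_
  obtain ⟨g, hg, hgc, hgs, hle⟩ := exists_contDiff_eLpNorm_sub_le (Lp.memLp v) hε
  have hgt : IsTestFunction 𝕜 t g := ⟨hg, hgc, hgs⟩
  refine ⟨_, ⟨g, hgt, rfl⟩, ?_⟩
  rw [Metric.mem_closedBall, dist_comm, Lp.dist_def]
  refine ENNReal.toReal_le_of_le_ofReal hε.le ((le_of_eq (eLpNorm_congr_ae ?_)).trans hle)
  filter_upwards [(hgt.memLp ((volume : Measure ℝ).restrict (Ioc 0 (t : ℝ)))).coeFn_toLp] with s hs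
  rw [Pi.sub_apply, Pi.sub_apply, hs]

theorem ext_isTestFunction {F : Type*} [NormedAddCommGroup F] [NormedSpace 𝕜 F]
    {L L' : L2 t U →L[𝕜] F}
    (h : ∀ g, ∀ hg : IsTestFunction 𝕜 t g, L ((hg.memLp _).toLp g) = L' ((hg.memLp _).toLp g)) :
    L = L' := by
  refine DFunLike.coe_injective (Continuous.ext_on (dense_isTestFunction (𝕜 := 𝕜) t)
    L.continuous L'.continuous ?_)
  rintro _ ⟨g, hg, rfl⟩
  exact h g hg

end Test

/-! ### Input-output maps -/

section InputOutput

open C0Semigroup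

variable {𝕜 X U Y : Type*} [RCLike 𝕜]
  [NormedAddCommGroup X] [NormedSpace 𝕜 X] [CompleteSpace X]
  [NormedAddCommGroup U] [NormedSpace 𝕜 U]
  [NormedAddCommGroup Y] [NormedSpace 𝕜 Y]
  {T : C0Semigroup 𝕜 X} {β : T.resolventSet} {B : U →L[𝕜] T.Xm1 β} {C : T.X1 β →L[𝕜] Y}
  {G : 𝕜 → U →L[𝕜] Y} {α : 𝕜}

/-- The values of the input-output map on `W^{1,2}` functions do not depend on the time horizon. -/
theorem IsInputOutputMap.ae_eq {t s : ℝ≥0} {F : L2 t U →L[𝕜] L2 t Y} {F' : L2 s U →L[𝕜] L2 s Y}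
    (hα : α ∈ T.rightHalfPlane) (h : IsInputOutputMap T β B C G t F)
    (h' : IsInputOutputMap T β B C G s F') (hts : t ≤ s) {u : ℝ → U} (hu : W12locZero 𝕜 u)
    {v : L2 t U} (hv : v =ᵐ[volume.restrict (Ioc 0 (t : ℝ))] u)
    {w : L2 s U} (hw : w =ᵐ[volume.restrict (Ioc 0 (s : ℝ))] u) :
    F v =ᵐ[volume.restrict (Ioc 0 (t : ℝ))] F' w := by
  have h1 := ae_restrict_of_ae_restrict_of_subset (Ioc_subset_Ioc_right (NNReal.coe_le_coe.2 hts))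
    (h' u hu w hw α hα)
  filter_upwards [h u hu v hv α hα, h1] with σ ⟨x, hx, hFx⟩ ⟨x', hx', hFx'⟩
  have : x = x' := emb_incl_injective (hx.trans hx'.symm)
  rw [hFx, hFx', this]

theorem isInputOutputMap_inputOutputMap {t : ℝ≥0} (h : ∃ F, IsInputOutputMap T β B C G t F) :
    IsInputOutputMap T β B C G t (inputOutputMap T β B C G t) := by
  rw [inputOutputMap, dif_pos h]
  exact h.choose_spec

variable [CompleteSpace U]

/-- Causality. -/
theorem IsInputOutputMap.head_comp {t s : ℝ≥0} {F : L2 (t + s) U →L[𝕜] L2 (t + s) Y}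
    {F' : L2 t U →L[𝕜] L2 t Y} (hα : α ∈ T.rightHalfPlane)
    (h : IsInputOutputMap T β B C G (t + s) F) (h' : IsInputOutputMap T β B C G t F') :
    (head 𝕜 t s).comp F = F'.comp (head 𝕜 t s) := by
  refine ext_isTestFunction fun g hg => Lp.ext ?_
  rw [ContinuousLinearMap.comp_apply, ContinuousLinearMap.comp_apply,
    head_toLp (hg.memLp _) (hg.memLp _)]
  exact (coeFn_head t s _).trans (h'.ae_eq hα h le_self_add hg.w12locZero
    (MemLp.coeFn_toLp _) (MemLp.coeFn_toLp _)).symm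

/-- An input which vanishes near the end point `t` of the time interval leads to a state in the
domain of the generator. -/
theorem exists_incl_eq_inputMap {M : ℝ} (hM : ∀ t, ‖T t‖ ≤ M) {t : ℝ≥0}
    {Φ : L2 t U →L[𝕜] X} {F : L2 t U →L[𝕜] L2 t Y} (hα : α ∈ T.rightHalfPlane)
    (hΦ : IsInputMap T β B t Φ) (hF : IsInputOutputMap T β B C G t F) {g : ℝ → U}
    (hg : IsTestFunction 𝕜 t g) : ∃ x : T.X1 β, X1.incl T β x = Φ ((hg.memLp _).toLp g) := by
  rcases eq_or_ne t 0 with rfl | ht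
  · refine ⟨0, T.emb_injective β ?_⟩
    rw [hΦ]
    simp [inputIntegral]
  have ht0 : (0 : ℝ) < t := by positivity
  have hz : g =ᶠ[𝓝 (t : ℝ)] 0 :=
    notMem_tsupport_iff_eventuallyEq.1 fun h => lt_irrefl _ (hg.2.2 h).2
  obtain ⟨a, hat, ha⟩ := (mem_nhdsLE_iff_exists_Ioc_subset' ht0).1 (mem_nhdsWithin_of_mem_nhds hz)
  have hsub : Ioo (max a 0) (t : ℝ) ⊆ Ioc 0 (t : ℝ) := fun r hr =>
    ⟨(le_max_right _ _).trans_lt hr.1, hr.2.le⟩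
  have hae := ae_restrict_of_ae_restrict_of_subset hsub
    (hF g hg.w12locZero _ (MemLp.coeFn_toLp (hg.memLp _)) α hα)
  have hne : (ae ((volume : Measure ℝ).restrict (Ioo (max a 0) (t : ℝ)))).NeBot := by
    rw [ae_restrict_neBot, Real.volume_Ioo]
    have : max a 0 < (t : ℝ) := max_lt hat ht0
    simpa using this
  obtain ⟨r, ⟨x, hx, -⟩, hr⟩ := (hae.and (ae_restrict_mem measurableSet_Ioo)).exists
  have har : a < r := (le_max_left _ _).trans_lt hr.1
  lift r to ℝ≥0 using (le_max_right _ _).trans hr.1.le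
  obtain ⟨q, rfl⟩ := exists_add_of_le (NNReal.coe_le_coe.1 hr.2.le)
  have hgr : g r = 0 := ha ⟨har, hr.2.le⟩
  rw [hgr, _root_.map_zero, _root_.map_zero, _root_.map_zero, sub_zero] at hx
  refine ⟨X1.orbit T β q x, T.emb_injective β ?_⟩
  rw [hΦ, inputIntegral_congr (MemLp.coeFn_toLp (hg.memLp _)), inputIntegral_add hM (hg.memLp _),
    ← hx, T.Tm1_emb, incl_orbit, inputIntegral_eq_zero, add_zero]
  refine ae_restrict_of_forall_mem measurableSet_Ioc fun σ hσ => ?_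
  exact ha ⟨by linarith [hσ.1], by push_cast; linarith [hσ.2]⟩

/-- After the input has ended, the output is that of the free evolution. -/
theorem IsInputOutputMap.tail_comp_padRight {M : ℝ} (hM : ∀ t, ‖T t‖ ≤ M) {t s : ℝ≥0}
    {F : L2 (t + s) U →L[𝕜] L2 (t + s) Y} {F' : L2 t U →L[𝕜] L2 t Y}
    {Φ : L2 t U →L[𝕜] X} {Ψ : X →L[𝕜] L2 s Y} (hα : α ∈ T.rightHalfPlane)
    (h : IsInputOutputMap T β B C G (t + s) F) (h' : IsInputOutputMap T β B C G t F')
    (hΦ : IsInputMap T β B t Φ) (hΨ : IsOutputMap T β C s Ψ) :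
    ((tail 𝕜 t s).comp F).comp (padRight 𝕜 t s) = Ψ.comp Φ := by
  refine ext_isTestFunction fun g hg => Lp.ext ?_
  obtain ⟨x, hx⟩ := exists_incl_eq_inputMap hM hα hΦ h' hg
  have hpad : padRight 𝕜 t s ((hg.memLp _).toLp g) = (hg.memLp _).toLp g := by
    refine window_eq_toLp _ _ _ fun σ hσ => ?_
    rw [add_zero]
    by_cases hσt : σ ∈ Ioc 0 (t : ℝ)
    · rw [indicator_of_mem hσt]
    · rw [indicator_of_notMem hσt, hg.eq_zero fun hσ' => hσt (Ioo_subset_Ioc_self hσ')]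
  have hF := ae_restrict_Ioc_shift
    (h g hg.w12locZero _ (MemLp.coeFn_toLp (hg.memLp _)) α hα)
  have hΨx := hΨ x
  rw [hx] at hΨx
  simp only [ContinuousLinearMap.comp_apply]
  rw [hpad]
  filter_upwards [coeFn_tail (𝕜 := 𝕜) t s (F ((hg.memLp _).toLp g)), hF, hΨx,
    ae_restrict_mem measurableSet_Ioc] with σ h₁ ⟨x', hx', hFx'⟩ h₃ hσ
  have hend : ∀ r, 0 < r → g (t + r) = 0 := fun r hr => hg.eq_zero fun h => by linarith [h.2]
  lift σ to ℝ≥0 using hσ.1.le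
  have hxx : x' = X1.orbit T β σ x := by
    refine emb_incl_injective (hx'.trans ?_)
    rw [hend _ hσ.1, _root_.map_zero, _root_.map_zero, _root_.map_zero, sub_zero, ← NNReal.coe_add,
      inputIntegral_add hM (hg.memLp _), inputIntegral_eq_zero (u := fun r => g (t + r)), add_zero]
    · beta_reduce
      rw [incl_orbit, hx, ← T.Tm1_emb, hΦ, inputIntegral_congr (MemLp.coeFn_toLp (hg.memLp _))]
    · exact ae_restrict_of_forall_mem measurableSet_Ioc fun r hr => hend r hr.1
  rw [h₁, hFx', h₃, hend _ hσ.1, _root_.map_zero, add_zero, hxx, Real.toNNReal_coe]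

/-- Time invariance. -/
theorem IsInputOutputMap.tail_comp_padLeft {M : ℝ} (hM : ∀ t, ‖T t‖ ≤ M) {t s : ℝ≥0}
    {F : L2 (t + s) U →L[𝕜] L2 (t + s) Y} {F' : L2 s U →L[𝕜] L2 s Y} (hα : α ∈ T.rightHalfPlane)
    (h : IsInputOutputMap T β B C G (t + s) F) (h' : IsInputOutputMap T β B C G s F') :
    ((tail 𝕜 t s).comp F).comp (padLeft 𝕜 t s) = F' := by
  refine ext_isTestFunction fun g hg => Lp.ext ?_
  have hmem : ∀ S, MemLp (fun r => g (r - t)) 2 ((volume : Measure ℝ).restrict S) := fun S =>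
    ((hg.memLp volume).comp_measurePreserving (measurePreserving_sub_right volume (t : ℝ))).restrict S
  have hpad : padLeft 𝕜 t s ((hg.memLp _).toLp g) = (hmem _).toLp _ := by
    refine window_eq_toLp _ _ _ fun σ hσ => ?_
    rw [← sub_eq_add_neg]
    by_cases hσt : σ - t ∈ Ioc 0 (s : ℝ)
    · rw [indicator_of_mem hσt]
    · rw [indicator_of_notMem hσt, hg.eq_zero fun hσ' => hσt (Ioo_subset_Ioc_self hσ')]
  have hF := ae_restrict_Ioc_shift
    (h _ (hg.w12locZero_sub t) _ (MemLp.coeFn_toLp (hmem _)) α hα)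
  simp only [ContinuousLinearMap.comp_apply]
  rw [hpad]
  filter_upwards [coeFn_tail (𝕜 := 𝕜) t s (F ((hmem _).toLp _)), hF,
    h' g hg.w12locZero _ (MemLp.coeFn_toLp (hg.memLp _)) α hα,
    ae_restrict_mem measurableSet_Ioc] with σ h₁ ⟨x, hx, hFx⟩ ⟨x', hx', hFx'⟩ hσ
  have hxx : x = x' := by
    refine emb_incl_injective (hx.trans (Eq.trans ?_ hx'.symm))
    lift σ to ℝ≥0 using hσ.1.le
    rw [← NNReal.coe_add, inputIntegral_add hM (hmem _),
      inputIntegral_eq_zero (u := fun r => g (r - t)), _root_.map_zero, zero_add, NNReal.coe_add]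
    · simp only [add_sub_cancel_left]
    · exact ae_restrict_of_forall_mem measurableSet_Ioc fun r hr =>
        hg.eq_zero fun h => by linarith [h.1, hr.2]
  rw [h₁, hFx, hFx', hxx, add_sub_cancel_left]

theorem IsInputOutputMap.tail_comp {M : ℝ} (hM : ∀ t, ‖T t‖ ≤ M) {t s : ℝ≥0}
    {F : L2 (t + s) U →L[𝕜] L2 (t + s) Y} {F₁ : L2 t U →L[𝕜] L2 t Y} {F₂ : L2 s U →L[𝕜] L2 s Y}
    {Φ : L2 t U →L[𝕜] X} {Ψ : X →L[𝕜] L2 s Y} (hα : α ∈ T.rightHalfPlane)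
    (h : IsInputOutputMap T β B C G (t + s) F) (h₁ : IsInputOutputMap T β B C G t F₁)
    (h₂ : IsInputOutputMap T β B C G s F₂)
    (hΦ : IsInputMap T β B t Φ) (hΨ : IsOutputMap T β C s Ψ) (v : L2 (t + s) U) :
    tail 𝕜 t s (F v) = Ψ (Φ (head 𝕜 t s v)) + F₂ (tail 𝕜 t s v) := by
  conv_lhs => rw [← padRight_head_add_padLeft_tail (𝕜 := 𝕜) t s v, _root_.map_add, _root_.map_add]
  exact congrArg₂ (· + ·)
    (DFunLike.congr_fun (h.tail_comp_padRight hM hα h₁ hΦ hΨ) (head 𝕜 t s v))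
    (DFunLike.congr_fun (h.tail_comp_padLeft hM hα h₂) (tail 𝕜 t s v))

end InputOutput

/-! ### Exponentially weighted energies -/

section Energy

variable {E : Type*} [NormedAddCommGroup E]

/-- The square `∫₀ᵗ e^{2ωs} ‖u(s)‖² ds` of the exponentially weighted norm of `u` in
`L²(0,t;E)`. -/
def energy (ω : ℝ) (t : ℝ≥0) (u : ℝ → E) : ℝ≥0∞ :=
  ∫⁻ s in Ioc 0 (t : ℝ), ENNReal.ofReal (Real.exp (2 * ω * s)) * ‖u s‖ₑ ^ 2

theorem energy_congr {ω : ℝ} {t : ℝ≥0} {u v : ℝ → E}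
    (h : u =ᵐ[volume.restrict (Ioc 0 (t : ℝ))] v) : energy ω t u = energy ω t v :=
  lintegral_congr_ae (by filter_upwards [h] with s hs; rw [hs])

theorem energy_mono (ω : ℝ) {t s : ℝ≥0} (hts : t ≤ s) (u : ℝ → E) :
    energy ω t u ≤ energy ω s u :=
  lintegral_mono_set (Ioc_subset_Ioc_right (NNReal.coe_le_coe.2 hts))

theorem energy_add (ω : ℝ) (t s : ℝ≥0) (u : ℝ → E) :
    energy ω (t + s) u = energy ω t u
      + ENNReal.ofReal (Real.exp (2 * ω * t)) * energy ω s (fun σ => u (t + σ)) := by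
  have hun : Ioc 0 ((t + s : ℝ≥0) : ℝ) = Ioc 0 (t : ℝ) ∪ Ioc (t : ℝ) ((t + s : ℝ≥0) : ℝ) :=
    (Ioc_union_Ioc_eq_Ioc t.2 (by simp)).symm
  rw [energy, hun, lintegral_union measurableSet_Ioc (Ioc_disjoint_Ioc_of_le le_rfl)]
  congr 1
  have hpre : (fun σ => (t : ℝ) + σ) ⁻¹' Ioc (t : ℝ) ((t + s : ℝ≥0) : ℝ) = Ioc 0 (s : ℝ) := by
    ext σ
    simp
  rw [energy, ← (measurePreserving_add_left volume (t : ℝ)).setLIntegral_comp_preimage_emb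
      (measurableEmbedding_addLeft (t : ℝ)), hpre, ← lintegral_const_mul' _ _ ENNReal.ofReal_ne_top]
  refine lintegral_congr fun σ => ?_
  rw [← mul_assoc, ← ENNReal.ofReal_mul (Real.exp_nonneg _), ← Real.exp_add]
  congr 4
  ring

theorem eLpNorm_two_sq (u : ℝ → E) (μ : Measure ℝ) : eLpNorm u 2 μ ^ 2 = ∫⁻ s, ‖u s‖ₑ ^ 2 ∂μ := by
  have h := eLpNorm_nnreal_pow_eq_lintegral (μ := μ) (f := u) (p := 2) two_ne_zero
  simpa using h

theorem enorm_sq_eq_lintegral {t : ℝ≥0} (v : L2 t E) :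
    ‖v‖ₑ ^ 2 = ∫⁻ s in Ioc 0 (t : ℝ), ‖v s‖ₑ ^ 2 := by
  rw [Lp.enorm_def, eLpNorm_two_sq]

theorem enorm_sq_le_energy {ω : ℝ} (hω : 0 ≤ ω) {t : ℝ≥0} (v : L2 t E) :
    ‖v‖ₑ ^ 2 ≤ energy ω t v := by
  rw [enorm_sq_eq_lintegral, energy]
  refine setLIntegral_mono' measurableSet_Ioc fun s hs => le_mul_of_one_le_left zero_le ?_
  rw [ENNReal.one_le_ofReal, Real.one_le_exp_iff]
  have := hs.1.le
  positivity

theorem energy_le_enorm_sq {ω : ℝ} (hω : 0 ≤ ω) {t : ℝ≥0} (v : L2 t E) :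
    energy ω t v ≤ ENNReal.ofReal (Real.exp (2 * ω * t)) * ‖v‖ₑ ^ 2 := by
  rw [enorm_sq_eq_lintegral, ← lintegral_const_mul' _ _ ENNReal.ofReal_ne_top]
  refine setLIntegral_mono' measurableSet_Ioc fun s hs => ?_
  gcongr
  exact hs.2

theorem ofReal_exp_add (ω : ℝ) (t s : ℝ≥0) :
    ENNReal.ofReal (Real.exp (2 * ω * ((t + s : ℝ≥0) : ℝ)))
      = ENNReal.ofReal (Real.exp (2 * ω * t)) * ENNReal.ofReal (Real.exp (2 * ω * s)) := by
  rw [← ENNReal.ofReal_mul (Real.exp_nonneg _), ← Real.exp_add, NNReal.coe_add, mul_add]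

theorem add_sq_le_two_mul (a b : ℝ≥0∞) : (a + b) ^ 2 ≤ 2 * (a ^ 2 + b ^ 2) := by
  have h := ENNReal.rpow_add_le_mul_rpow_add_rpow a b one_le_two
  norm_num at h
  exact h

theorem enorm_add_sq_le (x y : E) : ‖x + y‖ₑ ^ 2 ≤ 2 * (‖x‖ₑ ^ 2 + ‖y‖ₑ ^ 2) := by
  refine le_trans ?_ (add_sq_le_two_mul _ _)
  gcongr
  exact enorm_add_le x y

theorem enorm_sq_le_of_norm_le {F : Type*} [NormedAddCommGroup F] {x : E} {y : F} {m : ℝ≥0}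
    (h : ‖x‖ ≤ m * ‖y‖) : ‖x‖ₑ ^ 2 ≤ (m : ℝ≥0∞) ^ 2 * ‖y‖ₑ ^ 2 := by
  rw [← mul_pow]
  gcongr
  rw [enorm_eq_nnnorm, enorm_eq_nnnorm, ← ENNReal.coe_mul, ENNReal.coe_le_coe]
  exact h

end Energy

/-! ### Well-posed linear systems -/

section System

variable {𝕜 X U Y : Type*} [RCLike 𝕜]
  [NormedAddCommGroup X] [NormedSpace 𝕜 X]
  [NormedAddCommGroup U] [NormedSpace 𝕜 U]
  [NormedAddCommGroup Y] [NormedSpace 𝕜 Y]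

variable (𝕜 X U Y) in
/-- A well-posed linear system: a semigroup `T`, input maps `Φ_t`, output maps `Ψ_t` and
input-output maps `F_t` which are causal and time invariant. -/
structure LinearSystem where
  T : C0Semigroup 𝕜 X
  Φ : ∀ t : ℝ≥0, L2 t U →L[𝕜] X
  Ψ : ∀ t : ℝ≥0, X →L[𝕜] L2 t Y
  F : ∀ t : ℝ≥0, L2 t U →L[𝕜] L2 t Y
  Φ_add : ∀ t s v, Φ (t + s) v = T s (Φ t (head 𝕜 t s v)) + Φ s (tail 𝕜 t s v)
  head_Ψ : ∀ t s x, head 𝕜 t s (Ψ (t + s) x) = Ψ t x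
  tail_Ψ : ∀ t s x, tail 𝕜 t s (Ψ (t + s) x) = Ψ s (T t x)
  head_F : ∀ t s v, head 𝕜 t s (F (t + s) v) = F t (head 𝕜 t s v)
  tail_F : ∀ t s v, tail 𝕜 t s (F (t + s) v) = Ψ s (Φ t (head 𝕜 t s v)) + F s (tail 𝕜 t s v)

namespace LinearSystem

variable (S : LinearSystem 𝕜 X U Y)

/-- The state at time `t` for the initial state `x` and the input `v`. -/
def state (t : ℝ≥0) (x : X) (v : L2 t U) : X := S.T t x + S.Φ t v

/-- The output on `(0,t]` for the initial state `x` and the input `v`. -/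
def output (t : ℝ≥0) (x : X) (v : L2 t U) : L2 t Y := S.Ψ t x + S.F t v

theorem state_add (t s : ℝ≥0) (x : X) (v : L2 (t + s) U) :
    S.state (t + s) x v = S.state s (S.state t x (head 𝕜 t s v)) (tail 𝕜 t s v) := by
  have hTts : S.T (t + s) x = S.T s (S.T t x) := by rw [add_comm, semigroup_add_apply]
  rw [state, state, state, S.Φ_add, hTts, map_add, add_assoc]

theorem head_output (t s : ℝ≥0) (x : X) (v : L2 (t + s) U) :
    head 𝕜 t s (S.output (t + s) x v) = S.output t x (head 𝕜 t s v) := by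
  rw [output, output, map_add, S.head_Ψ, S.head_F]

theorem tail_output (t s : ℝ≥0) (x : X) (v : L2 (t + s) U) :
    tail 𝕜 t s (S.output (t + s) x v)
      = S.output s (S.state t x (head 𝕜 t s v)) (tail 𝕜 t s v) := by
  rw [output, output, state, map_add, map_add, S.tail_Ψ, S.tail_F, add_assoc]

theorem Φ_padLeft (t s : ℝ≥0) (v : L2 s U) : S.Φ (t + s) (padLeft 𝕜 t s v) = S.Φ s v := by
  rw [S.Φ_add, head_padLeft, tail_padLeft, map_zero, map_zero, zero_add]

theorem norm_Φ_le {t h : ℝ≥0} (hth : t ≤ h) (v : L2 t U) : ‖S.Φ t v‖ ≤ ‖S.Φ h‖ * ‖v‖ := by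
  obtain ⟨s, rfl⟩ := exists_add_of_le hth
  rw [add_comm, ← S.Φ_padLeft s t v]
  exact (ContinuousLinearMap.le_opNorm _ _).trans
    (mul_le_mul_of_nonneg_left (norm_window_le _ _ _ v) (norm_nonneg _))

theorem norm_Ψ_le {t h : ℝ≥0} (hth : t ≤ h) (x : X) : ‖S.Ψ t x‖ ≤ ‖S.Ψ h‖ * ‖x‖ := by
  obtain ⟨s, rfl⟩ := exists_add_of_le hth
  rw [← S.head_Ψ t s x]
  exact (norm_window_le _ _ _ _).trans (ContinuousLinearMap.le_opNorm _ _)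

theorem norm_F_le {t h : ℝ≥0} (hth : t ≤ h) (v : L2 t U) : ‖S.F t v‖ ≤ ‖S.F h‖ * ‖v‖ := by
  obtain ⟨s, rfl⟩ := exists_add_of_le hth
  conv_lhs => rw [← head_padRight (𝕜 := 𝕜) t s v, ← S.head_F]
  exact (norm_window_le _ _ _ _).trans ((ContinuousLinearMap.le_opNorm _ _).trans
    (mul_le_mul_of_nonneg_left (norm_window_le _ _ _ v) (norm_nonneg _)))

/-- The weighted energy of the output plus the weighted square of the final state. -/
def totalEnergy (ω : ℝ) (t : ℝ≥0) (x : X) (v : L2 t U) : ℝ≥0∞ :=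
  ENNReal.ofReal (Real.exp (2 * ω * t)) * ‖S.state t x v‖ₑ ^ 2 + energy ω t (S.output t x v)

theorem totalEnergy_add (ω : ℝ) (t s : ℝ≥0) (x : X) (v : L2 (t + s) U) :
    S.totalEnergy ω (t + s) x v = energy ω t (S.output t x (head 𝕜 t s v))
      + ENNReal.ofReal (Real.exp (2 * ω * t))
        * S.totalEnergy ω s (S.state t x (head 𝕜 t s v)) (tail 𝕜 t s v) := by
  rw [totalEnergy, totalEnergy, energy_add, state_add, ← head_output, ← tail_output,
    energy_congr (coeFn_head (𝕜 := 𝕜) t s _), energy_congr (coeFn_tail (𝕜 := 𝕜) t s _), mul_add,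
    ← mul_assoc, ofReal_exp_add]
  ac_rfl

theorem energy_coe_add (ω : ℝ) (t s : ℝ≥0) (v : L2 (t + s) U) :
    energy ω (t + s) v = energy ω t (head 𝕜 t s v)
      + ENNReal.ofReal (Real.exp (2 * ω * t)) * energy ω s (tail 𝕜 t s v) := by
  rw [energy_add, energy_congr (coeFn_head (𝕜 := 𝕜) t s _),
    energy_congr (coeFn_tail (𝕜 := 𝕜) t s _)]

/-- On a bounded time interval the weights are irrelevant and the total energy is controlled by the
norms of the operators of the system. -/
theorem totalEnergy_le_of_le {ω : ℝ} (hω : 0 ≤ ω) {m h : ℝ≥0} (hT : ∀ t, ‖S.T t‖ ≤ m)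
    (hΦ : ‖S.Φ h‖ ≤ m) (hΨ : ‖S.Ψ h‖ ≤ m) (hF : ‖S.F h‖ ≤ m) {t : ℝ≥0} (ht : t ≤ h) (x : X)
    (v : L2 t U) :
    S.totalEnergy ω t x v ≤ ENNReal.ofReal (Real.exp (2 * ω * h)) * (4 * m ^ 2)
      * (‖x‖ₑ ^ 2 + ‖v‖ₑ ^ 2) := by
  have hexp : ENNReal.ofReal (Real.exp (2 * ω * t)) ≤ ENNReal.ofReal (Real.exp (2 * ω * h)) := by
    gcongr
  have h1 : ‖S.state t x v‖ₑ ^ 2 ≤ 2 * m ^ 2 * (‖x‖ₑ ^ 2 + ‖v‖ₑ ^ 2) := by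
    refine (enorm_add_sq_le _ _).trans ?_
    rw [mul_assoc, mul_add ((m : ℝ≥0∞) ^ 2)]
    gcongr
    · exact enorm_sq_le_of_norm_le ((S.T t).le_of_opNorm_le (hT t) x)
    · exact enorm_sq_le_of_norm_le ((S.norm_Φ_le ht v).trans (by gcongr))
  have h2 : ‖S.output t x v‖ₑ ^ 2 ≤ 2 * m ^ 2 * (‖x‖ₑ ^ 2 + ‖v‖ₑ ^ 2) := by
    refine (enorm_add_sq_le _ _).trans ?_
    rw [mul_assoc, mul_add ((m : ℝ≥0∞) ^ 2)]
    gcongr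
    · exact enorm_sq_le_of_norm_le ((S.norm_Ψ_le ht x).trans (by gcongr))
    · exact enorm_sq_le_of_norm_le ((S.norm_F_le ht v).trans (by gcongr))
  calc S.totalEnergy ω t x v
      ≤ ENNReal.ofReal (Real.exp (2 * ω * h)) * (2 * m ^ 2 * (‖x‖ₑ ^ 2 + ‖v‖ₑ ^ 2))
        + ENNReal.ofReal (Real.exp (2 * ω * h)) * (2 * m ^ 2 * (‖x‖ₑ ^ 2 + ‖v‖ₑ ^ 2)) := by
        refine add_le_add (by gcongr) ((energy_le_enorm_sq hω _).trans (by gcongr))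
    _ = _ := by ring

/-- If the free evolution over a time `h` contracts in the weighted norm, then the total energy is
controlled by the initial state and the energy of the input, uniformly in time: part of the
weighted square of the state at time `h` is absorbed in each step of length `h`. -/
theorem totalEnergy_le_of_contraction {ω : ℝ} (hω : 0 ≤ ω) {m h : ℝ≥0} (hh : 0 < h)
    (hT : ∀ t, ‖S.T t‖ ≤ m) (hΦ : ‖S.Φ h‖ ≤ m) (hΨ : ‖S.Ψ h‖ ≤ m) (hF : ‖S.F h‖ ≤ m)
    (hTh : 4 * (ENNReal.ofReal (Real.exp (2 * ω * h)) * ‖S.T h‖ₑ ^ 2) ≤ 1) :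
    ∃ c : ℝ≥0, ∀ t x, ∀ v : L2 t U,
      S.totalEnergy ω t x v ≤ c * (‖x‖ₑ ^ 2 + energy ω t v) := by
  set e : ℝ≥0∞ := ENNReal.ofReal (Real.exp (2 * ω * h)) with he
  set c₀ : ℝ≥0∞ := e * (4 * m ^ 2) with hc₀
  have hc₀t : c₀ ≠ ⊤ := by finiteness
  have hbase : ∀ t ≤ h, ∀ x, ∀ v : L2 t U,
      S.totalEnergy ω t x v ≤ c₀ * (‖x‖ₑ ^ 2 + energy ω t v) := fun t ht x v => by
    refine (S.totalEnergy_le_of_le hω hT hΦ hΨ hF ht x v).trans ?_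
    gcongr
    exact enorm_sq_le_energy hω v
  have hstate : ∀ x, ∀ v : L2 h U,
      2 * (e * ‖S.state h x v‖ₑ ^ 2) ≤ ‖x‖ₑ ^ 2 + c₀ * energy ω h v := fun x v => by
    calc 2 * (e * ‖S.state h x v‖ₑ ^ 2)
        ≤ 2 * (e * (2 * ((‖S.T h‖ₑ * ‖x‖ₑ) ^ 2 + m ^ 2 * ‖v‖ₑ ^ 2))) := by
          gcongr
          refine (enorm_add_sq_le _ _).trans ?_
          gcongr
          · exact (S.T h).le_opENorm x
          · exact enorm_sq_le_of_norm_le ((S.Φ h).le_of_opNorm_le hΦ v)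
      _ = 4 * (e * ‖S.T h‖ₑ ^ 2) * ‖x‖ₑ ^ 2 + c₀ * ‖v‖ₑ ^ 2 := by rw [hc₀]; ring
      _ ≤ 1 * ‖x‖ₑ ^ 2 + c₀ * energy ω h v := by
          gcongr
          exact enorm_sq_le_energy hω v
      _ = _ := by rw [one_mul]
  have hmain : ∀ n : ℕ, ∀ t ≤ (n + 1) • h, ∀ x, ∀ v : L2 t U, S.totalEnergy ω t x v
      ≤ 2 * c₀ * ‖x‖ₑ ^ 2 + (c₀ + c₀ * c₀) * energy ω t v := by
    intro n
    induction n with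
    | zero =>
      intro t ht x v
      rw [zero_add, one_nsmul] at ht
      refine (hbase t ht x v).trans ?_
      rw [mul_add]
      gcongr
      · exact le_mul_of_one_le_left zero_le one_le_two
      · exact le_self_add
    | succ n ih =>
      intro t ht x v
      rcases le_total t h with hth | hth
      · exact ih t (hth.trans (by rw [succ_nsmul]; exact le_add_self)) x v
      obtain ⟨s, rfl⟩ := exists_add_of_le hth
      have hs : s ≤ (n + 1) • h := by
        rw [succ_nsmul, add_comm _ h] at ht
        exact le_of_add_le_add_left ht
      rw [S.totalEnergy_add, energy_coe_add (𝕜 := 𝕜)]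
      set x₁ := S.state h x (head 𝕜 h s v)
      calc energy ω h (S.output h x (head 𝕜 h s v))
            + e * S.totalEnergy ω s x₁ (tail 𝕜 h s v)
          ≤ c₀ * (‖x‖ₑ ^ 2 + energy ω h (head 𝕜 h s v))
            + e * (2 * c₀ * ‖x₁‖ₑ ^ 2 + (c₀ + c₀ * c₀) * energy ω s (tail 𝕜 h s v)) := by
            gcongr
            · exact le_add_self.trans (hbase h le_rfl x _)
            · exact ih s hs x₁ _
        _ = c₀ * (‖x‖ₑ ^ 2 + energy ω h (head 𝕜 h s v)) + c₀ * (2 * (e * ‖x₁‖ₑ ^ 2))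
            + (c₀ + c₀ * c₀) * (e * energy ω s (tail 𝕜 h s v)) := by ring
        _ ≤ c₀ * (‖x‖ₑ ^ 2 + energy ω h (head 𝕜 h s v))
            + c₀ * (‖x‖ₑ ^ 2 + c₀ * energy ω h (head 𝕜 h s v))
            + (c₀ + c₀ * c₀) * (e * energy ω s (tail 𝕜 h s v)) := by
            gcongr
            exact hstate x _
        _ = _ := by ring
  refine ⟨(2 * c₀ + (c₀ + c₀ * c₀)).toNNReal, fun t x v => ?_⟩
  rw [ENNReal.coe_toNNReal (by finiteness)]
  obtain ⟨n, hn⟩ := Archimedean.arch t hh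
  refine (hmain n t (hn.trans (by rw [succ_nsmul]; exact le_self_add)) x v).trans ?_
  rw [mul_add]
  gcongr ?_ * _ + ?_ * _
  · exact le_self_add
  · exact le_add_self

/-- Exponential stability of the semigroup gives weighted estimates for the linear system, for
every weight below the decay rate. -/
theorem exists_totalEnergy_le {M lam ω : ℝ} (hT : ∀ t, ‖S.T t‖ ≤ M * Real.exp (-lam * t))
    (hω : 0 ≤ ω) (hωlam : ω < lam) :
    ∃ c : ℝ≥0, ∀ t x, ∀ v : L2 t U,
      S.totalEnergy ω t x v ≤ c * (‖x‖ₑ ^ 2 + energy ω t v) := by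
  have hM : 0 ≤ M := by simpa using (norm_nonneg _).trans (hT 0)
  have hlim : Tendsto (fun h : ℝ => M * Real.exp (-(lam - ω) * h)) atTop (𝓝 (M * 0)) :=
    (Real.tendsto_exp_atBot.comp
      (tendsto_id.const_mul_atTop_of_neg (by linarith : -(lam - ω) < 0))).const_mul M
  rw [mul_zero] at hlim
  obtain ⟨h, hh, hh0⟩ := ((hlim.eventually_le_const (u := 1 / 2) (by norm_num)).and
    (eventually_gt_atTop 0)).exists
  lift h to ℝ≥0 using hh0.le
  have hTM : ∀ t, ‖S.T t‖ ≤ M := fun t => (hT t).trans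
    (mul_le_of_le_one_right hM (Real.exp_le_one_iff.2 (by nlinarith [t.coe_nonneg])))
  set m : ℝ≥0 := M.toNNReal + ‖S.Φ h‖₊ + ‖S.Ψ h‖₊ + ‖S.F h‖₊ with hm
  have hbd : M ≤ m ∧ ‖S.Φ h‖ ≤ m ∧ ‖S.Ψ h‖ ≤ m ∧ ‖S.F h‖ ≤ m := by
    have h1 := Real.le_coe_toNNReal M
    have h2 := norm_nonneg (S.Φ h)
    have h3 := norm_nonneg (S.Ψ h)
    have h4 := norm_nonneg (S.F h)
    simp only [hm, NNReal.coe_add, coe_nnnorm]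
    refine ⟨?_, ?_, ?_, ?_⟩ <;> linarith
  refine S.totalEnergy_le_of_contraction hω (m := m) (NNReal.coe_pos.1 hh0)
    (fun t => (hTM t).trans hbd.1) hbd.2.1 hbd.2.2.1 hbd.2.2.2 ?_
  have h1 : Real.exp (ω * h) * ‖S.T h‖ ≤ 1 / 2 := by
    refine le_trans (mul_le_mul_of_nonneg_left (hT h) (Real.exp_nonneg _)) (le_trans ?_ hh)
    rw [mul_left_comm, ← Real.exp_add]
    exact le_of_eq (by ring_nf)
  have h2 : Real.exp (2 * ω * h) * ‖S.T h‖ ^ 2 ≤ 1 / 4 := by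
    have : Real.exp (2 * ω * h) = Real.exp (ω * h) ^ 2 := by
      rw [← Real.exp_nat_mul]
      push_cast
      ring_nf
    rw [this, ← mul_pow]
    calc (Real.exp (ω * h) * ‖S.T h‖) ^ 2 ≤ (1 / 2) ^ 2 := by gcongr
      _ = 1 / 4 := by norm_num
  rw [← ofReal_norm, ← ENNReal.ofReal_pow (norm_nonneg _),
    ← ENNReal.ofReal_mul (Real.exp_nonneg _), ← ENNReal.ofReal_ofNat 4,
    ← ENNReal.ofReal_mul (by norm_num), ENNReal.ofReal_le_one]
  linarith

end LinearSystem

end System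

section

variable {𝕜 X U Y : Type*} [RCLike 𝕜]
  [NormedAddCommGroup X] [NormedSpace 𝕜 X]
  [NormedAddCommGroup U] [NormedSpace 𝕜 U]
  [NormedAddCommGroup Y] [NormedSpace 𝕜 Y]

/-! ### The linear system of a well-posed triple -/

section OfWellPosed

variable [CompleteSpace X] [CompleteSpace U] {T : C0Semigroup 𝕜 X} {β : T.resolventSet}
  {B : U →L[𝕜] T.Xm1 β} {C : T.X1 β →L[𝕜] Y} {G : 𝕜 → U →L[𝕜] Y}

/-- The input, output and input-output maps of `(A,B,C)` and `G` form a linear system. -/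
def LinearSystem.ofWellPosed {M : ℝ} (hM : ∀ t, ‖T t‖ ≤ M) (hα : T.rightHalfPlane.Nonempty)
    (hB : AdmissibleControl T β B) (hC : AdmissibleObservation T β C)
    (hG : ∀ t : ℝ≥0, ∃ F, IsInputOutputMap T β B C G t F) : LinearSystem 𝕜 X U Y where
  T := T
  Φ := inputMap T β B
  Ψ := outputMap T β C
  F := inputOutputMap T β B C G
  Φ_add t s v := by
    have hΦ := fun t => isInputMap_inputMap (hB.exists_isInputMap hM t)
    rw [(hΦ (t + s)).unique ((hΦ t).add hM (hΦ s))]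
    rfl
  head_Ψ t s x := by
    have hΨ := fun t => isOutputMap_outputMap (hC.exists_isOutputMap t)
    rw [← (hΨ (t + s)).head.unique (hΨ t)]
    rfl
  tail_Ψ t s x := by
    have hΨ := fun t => isOutputMap_outputMap (hC.exists_isOutputMap t)
    exact DFunLike.congr_fun ((hΨ (t + s)).tail (hΨ s)) x
  head_F t s v := by
    have hF := fun t => isInputOutputMap_inputOutputMap (hG t)
    exact DFunLike.congr_fun ((hF (t + s)).head_comp hα.some_mem (hF t)) v
  tail_F t s v := by
    have hΦ := fun t => isInputMap_inputMap (hB.exists_isInputMap hM t)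
    have hΨ := fun t => isOutputMap_outputMap (hC.exists_isOutputMap t)
    have hF := fun t => isInputOutputMap_inputOutputMap (hG t)
    exact (hF (t + s)).tail_comp hM hα.some_mem (hF t) (hF s) (hΦ t) (hΨ s) v

end OfWellPosed

/-! ### Trajectories -/

section Glue

variable (𝕜) in
/-- A compatible family of elements of `L²(0,t;Y)` comes from one function in `L²_loc`. -/
theorem exists_L2loc_of_head {w : ∀ t : ℝ≥0, L2 t Y}
    (hw : ∀ t s, head 𝕜 t s (w (t + s)) = w t) :
    ∃ y, ∃ hy : L2loc y, ∀ t, (hy t).toLp y = w t := by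
  have hle : ∀ t s : ℝ≥0, t ≤ s → w s =ᵐ[volume.restrict (Ioc 0 (t : ℝ))] w t := by
    intro t s hts
    obtain ⟨r, rfl⟩ := exists_add_of_le hts
    rw [← hw t r]
    exact (coeFn_head t r _).symm
  set y : ℝ → Y := fun σ => w (⌈σ⌉₊ : ℕ) σ with hy
  have hyt : ∀ t : ℝ≥0, y =ᵐ[volume.restrict (Ioc 0 (t : ℝ))] w t := by
    intro t
    have h1 : ∀ k : ℕ, ∀ᵐ σ ∂(volume.restrict (Ioc 0 (t : ℝ))),
        σ ≤ (k : ℝ) → w (max t k) σ = w k σ := by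
      intro k
      have := (ae_restrict_iff' measurableSet_Ioc).1 (hle k (max t k) (le_max_right _ _))
      filter_upwards [ae_restrict_of_ae this, ae_restrict_mem measurableSet_Ioc] with σ h hσ hk
      exact h ⟨hσ.1, by simpa using hk⟩
    have h2 : ∀ k : ℕ, ∀ᵐ σ ∂(volume.restrict (Ioc 0 (t : ℝ))), w (max t k) σ = w t σ :=
      fun k => hle t (max t k) (le_max_left _ _)
    filter_upwards [ae_all_iff.2 h1, ae_all_iff.2 h2] with σ h1 h2
    rw [hy, ← h2 ⌈σ⌉₊, h1 _ (Nat.le_ceil σ)]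
  have hmem : L2loc y := fun t => (Lp.memLp (w t)).ae_eq (hyt t).symm
  exact ⟨y, hmem, fun t => Lp.ext ((hmem t).coeFn_toLp.trans (hyt t))⟩

end Glue

namespace LinearSystem

variable (S : LinearSystem 𝕜 X U Y)

/-- Translations act continuously on `L²`, and the effect of an input on the state at time `t` is
that of the translated input at a fixed later time. -/
theorem continuousOn_state (x : X) {u : ℝ → U} (hu : L2loc u) {z : ℝ → X}
    (hz : ∀ t : ℝ≥0, z t = S.state t x ((hu t).toLp u)) : ContinuousOn z (Ici 0) := by
  have : Fact ((2 : ℝ≥0∞) ≠ ⊤) := ⟨by simp⟩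
  have hΦ : ∀ τ : ℝ≥0, ∃ f : ℝ → X, Continuous f ∧
      ∀ t : ℝ≥0, t ≤ τ → S.Φ t ((hu t).toLp u) = f t := by
    intro τ
    have hû : MemLp ((Ioc 0 (τ : ℝ)).indicator u) 2 (volume : Measure ℝ) :=
      (memLp_indicator_iff_restrict measurableSet_Ioc).2 (hu τ)
    let û := hû.toLp _
    refine ⟨fun t => S.Φ τ (LpToLpRestrictCLM ℝ U 𝕜 volume 2 (Ioc 0 (τ : ℝ))
      (DomAddAct.mk (t - τ) +ᵥ û)), ?_, fun t ht => ?_⟩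
    · refine (S.Φ τ).continuous.comp ((ContinuousLinearMap.continuous _).comp ?_)
      exact (DomAddAct.continuous_mk.comp (continuous_id.sub continuous_const)).vadd
        continuous_const
    · obtain ⟨r, hr⟩ := exists_add_of_le ht
      obtain rfl : τ = r + t := by rw [hr, add_comm]
      have hr : (t : ℝ) - (r + t : ℝ≥0) = -r := by push_cast; ring
      rw [← S.Φ_padLeft r t]
      congr 1
      refine Lp.ext ?_
      have h₁ : (fun σ => û (-(r : ℝ) + σ))
          =ᵐ[volume] fun σ => (Ioc 0 ((r + t : ℝ≥0) : ℝ)).indicator u (-(r : ℝ) + σ) :=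
        (measurePreserving_add_left volume (-(r : ℝ))).quasiMeasurePreserving.ae_eq_comp
          hû.coeFn_toLp
      have h₂ := LpToLpRestrictCLM_coeFn (μ := volume) 𝕜 (Ioc 0 ((r + t : ℝ≥0) : ℝ))
        (DomAddAct.mk (-(r : ℝ)) +ᵥ û)
      rw [padLeft, window_toLp, hr]
      filter_upwards [MemLp.coeFn_toLp
        (memLp_indicator_translate (hu t) (-(r : ℝ)) (Ioc 0 ((r + t : ℝ≥0) : ℝ))),
        ae_restrict_of_ae h₁, h₂,
        ae_restrict_of_ae (DomAddAct.vadd_Lp_ae_eq (DomAddAct.mk (-(r : ℝ))) û),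
        ae_restrict_mem measurableSet_Ioc] with σ h₀ h₁ h₂ h₃ hσ
      rw [h₀, h₂, h₃, Equiv.symm_apply_apply, vadd_eq_add, h₁, add_comm σ]
      have hσt : -(r : ℝ) + σ ≤ t := by
        have := hσ.2
        push_cast at this
        linarith
      by_cases hσr : 0 < -(r : ℝ) + σ
      · have h₄ : -(r : ℝ) + σ ∈ Ioc 0 (t : ℝ) := ⟨hσr, hσt⟩
        rw [indicator_of_mem h₄, indicator_of_mem
          (Ioc_subset_Ioc_right (NNReal.coe_le_coe.2 (le_add_self : t ≤ r + t)) h₄)]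
      · rw [indicator_of_notMem fun h => hσr h.1, indicator_of_notMem fun h => hσr h.1]
  intro t₀ ht₀
  obtain ⟨f, hf, hfz⟩ := hΦ (t₀.toNNReal + 1)
  have hg : Continuous fun t : ℝ => S.T t.toNNReal x + f t :=
    ((S.T.continuous_orbit x).comp continuous_real_toNNReal).add hf
  refine (hg.continuousWithinAt (s := Ici 0) (x := t₀)).congr_of_eventuallyEq ?_ ?_
  · have : Iio (t₀ + 1) ∈ 𝓝[Ici 0] t₀ := mem_nhdsWithin_of_mem_nhds (Iio_mem_nhds (by linarith))
    filter_upwards [this, self_mem_nhdsWithin] with t ht ht0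
    lift t to ℝ≥0 using ht0
    lift t₀ to ℝ≥0 using ht₀
    rw [hz, state, Real.toNNReal_coe, hfz]
    rw [Real.toNNReal_coe, ← NNReal.coe_le_coe]
    exact (mem_Iio.1 ht).le
  · lift t₀ to ℝ≥0 using ht₀
    rw [hz, state, Real.toNNReal_coe, hfz]
    rw [Real.toNNReal_coe]
    exact le_self_add

/-- `z` and `y` are the state trajectory and the output of the system for the initial state `x₀`
and the input `u`. -/
structure IsTrajectory (x₀ : X) (u : ℝ → U) (z : ℝ → X) (y : ℝ → Y) : Prop where
  input_mem : L2loc u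
  output_mem : L2loc y
  state_eq : ∀ t : ℝ≥0, z t = S.state t x₀ ((input_mem t).toLp u)
  output_eq : ∀ t : ℝ≥0, (output_mem t).toLp y = S.output t x₀ ((input_mem t).toLp u)

theorem exists_isTrajectory (x₀ : X) {u : ℝ → U} (hu : L2loc u) :
    ∃ z y, S.IsTrajectory x₀ u z y := by
  obtain ⟨y, hy, hyt⟩ := exists_L2loc_of_head 𝕜 (w := fun t => S.output t x₀ ((hu t).toLp u))
    fun t s => by rw [head_output, head_toLp (hu (t + s)) (hu t)]
  exact ⟨fun t => S.state t.toNNReal x₀ ((hu _).toLp u), y, hu, hy,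
    fun t => by rw [Real.toNNReal_coe], hyt⟩

variable {S} {x₀ x₀' : X} {u u' : ℝ → U} {z z' : ℝ → X} {y y' : ℝ → Y}

theorem IsTrajectory.continuousOn (h : S.IsTrajectory x₀ u z y) : ContinuousOn z (Ici 0) :=
  S.continuousOn_state x₀ h.input_mem h.state_eq

theorem IsTrajectory.sub (h : S.IsTrajectory x₀ u z y) (h' : S.IsTrajectory x₀' u' z' y') :
    S.IsTrajectory (x₀ - x₀') (u - u') (z - z') (y - y') where
  input_mem t := (h.input_mem t).sub (h'.input_mem t)
  output_mem t := (h.output_mem t).sub (h'.output_mem t)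
  state_eq t := by
    rw [MemLp.toLp_sub (h.input_mem t) (h'.input_mem t), Pi.sub_apply, h.state_eq, h'.state_eq]
    simp only [state, map_sub]
    abel
  output_eq t := by
    rw [MemLp.toLp_sub (h.input_mem t) (h'.input_mem t),
      MemLp.toLp_sub (h.output_mem t) (h'.output_mem t), h.output_eq, h'.output_eq]
    simp only [output, map_sub]
    abel

theorem IsTrajectory.congr_input (h : S.IsTrajectory x₀ u z y)
    (huu' : ∀ t : ℝ≥0, u =ᵐ[volume.restrict (Ioc 0 (t : ℝ))] u') :
    S.IsTrajectory x₀ u' z y where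
  input_mem t := (h.input_mem t).ae_eq (huu' t)
  output_mem := h.output_mem
  state_eq t := by rw [h.state_eq, MemLp.toLp_congr _ _ (huu' t)]
  output_eq t := by rw [h.output_eq, MemLp.toLp_congr _ _ (huu' t)]

theorem IsTrajectory.energy_le {ω : ℝ} {c : ℝ≥0} (hc : ∀ t x, ∀ v : L2 t U,
      S.totalEnergy ω t x v ≤ c * (‖x‖ₑ ^ 2 + energy ω t v)) (h : S.IsTrajectory x₀ u z y)
    (t : ℝ≥0) : ENNReal.ofReal (Real.exp (2 * ω * t)) * ‖z t‖ₑ ^ 2 + energy ω t y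
      ≤ c * (‖x₀‖ₑ ^ 2 + energy ω t u) := by
  have := hc t x₀ ((h.input_mem t).toLp u)
  rwa [totalEnergy, ← h.state_eq, ← h.output_eq, energy_congr (h.input_mem t).coeFn_toLp,
    energy_congr (h.output_mem t).coeFn_toLp] at this

end LinearSystem

end

/-! ### The exponentially weighted `L²` space on the half-line -/

section Weighted

variable {E : Type*} [NormedAddCommGroup E]

/-- The measure `e^{2ωs} ds` on `(0,∞)`, whose `L²` space is `L²_ω(0,∞)`. -/
def expMeasure (ω : ℝ) : Measure ℝ :=
  (volume.restrict (Ioi 0)).withDensity fun s => ENNReal.ofReal (Real.exp (2 * ω * s))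

theorem measurable_ofReal_exp (ω : ℝ) :
    Measurable fun s : ℝ => ENNReal.ofReal (Real.exp (2 * ω * s)) := by fun_prop

theorem restrict_Ioi_absolutelyContinuous_expMeasure (ω : ℝ) :
    (volume : Measure ℝ).restrict (Ioi 0) ≪ expMeasure ω :=
  withDensity_absolutelyContinuous' (measurable_ofReal_exp ω).aemeasurable
    (ae_of_all _ fun _ => (ENNReal.ofReal_pos.2 (Real.exp_pos _)).ne')

theorem expMeasure_absolutelyContinuous (ω : ℝ) :
    expMeasure ω ≪ (volume : Measure ℝ).restrict (Ioi 0) :=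
  withDensity_absolutelyContinuous _ _

theorem eLpNorm_expMeasure_sq (ω : ℝ) (u : ℝ → E) : eLpNorm u 2 (expMeasure ω) ^ 2
    = ∫⁻ s in Ioi 0, ENNReal.ofReal (Real.exp (2 * ω * s)) * ‖u s‖ₑ ^ 2 := by
  rw [eLpNorm_two_sq, expMeasure, lintegral_withDensity_eq_lintegral_mul_non_measurable _
    (measurable_ofReal_exp ω) (ae_of_all _ fun s => ENNReal.ofReal_lt_top)]
  rfl

theorem energy_le_eLpNorm_sq (ω : ℝ) (t : ℝ≥0) (u : ℝ → E) :
    energy ω t u ≤ eLpNorm u 2 (expMeasure ω) ^ 2 := by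
  rw [eLpNorm_expMeasure_sq]
  exact lintegral_mono_set Ioc_subset_Ioi_self

theorem iUnion_Ioc_natCast : ⋃ n : ℕ, Ioc (0 : ℝ) n = Ioi 0 := by
  ext s
  simp only [mem_iUnion, mem_Ioc, mem_Ioi]
  exact ⟨fun ⟨n, h, _⟩ => h, fun h => ⟨⌈s⌉₊, h, Nat.le_ceil s⟩⟩

theorem eLpNorm_sq_le_of_energy_le {ω : ℝ} {u : ℝ → E} {a : ℝ≥0∞} (h : ∀ t, energy ω t u ≤ a) :
    eLpNorm u 2 (expMeasure ω) ^ 2 ≤ a := by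
  have hd : Directed (· ⊆ ·) fun n : ℕ => Ioc (0 : ℝ) n :=
    directed_of_isDirected_le fun m n hmn => Ioc_subset_Ioc_right (Nat.cast_le.2 hmn)
  rw [eLpNorm_expMeasure_sq, ← iUnion_Ioc_natCast, setLIntegral_iUnion_of_directed _ hd]
  exact iSup_le fun n => h n

theorem enorm_le_of_weighted {ω : ℝ} (hω : 0 ≤ ω) {t : ℝ} (ht : 0 ≤ t) {x : E} {a : ℝ≥0∞}
    (h : ENNReal.ofReal (Real.exp (ω * t)) * ‖x‖ₑ ≤ a) : ‖x‖ₑ ≤ a := by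
  refine le_trans (le_mul_of_one_le_left zero_le ?_) h
  rw [ENNReal.one_le_ofReal, Real.one_le_exp_iff]
  positivity

theorem L2loc.energy_ne_top {ω : ℝ} {u : ℝ → E} (hu : L2loc u) (hω : 0 ≤ ω) (t : ℝ≥0) :
    energy ω t u ≠ ⊤ := by
  rw [← energy_congr (hu t).coeFn_toLp]
  exact ne_top_of_le_ne_top (by finiteness) (energy_le_enorm_sq hω _)

theorem L2loc.aestronglyMeasurable {u : ℝ → E} (hu : L2loc u) :
    AEStronglyMeasurable u ((volume : Measure ℝ).restrict (Ioi 0)) := by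
  rw [← iUnion_Ioc_natCast, aestronglyMeasurable_iUnion_iff]
  exact fun n => (hu n).1

theorem L2loc.memLp_expMeasure {ω : ℝ} {u : ℝ → E} (hu : L2loc u)
    (h : eLpNorm u 2 (expMeasure ω) < ⊤) : MemLp u 2 (expMeasure ω) :=
  ⟨hu.aestronglyMeasurable.mono_ac (expMeasure_absolutelyContinuous ω), h⟩

theorem memLp_restrict_Ioi_of_expMeasure {ω : ℝ} (hω : 0 ≤ ω) {u : ℝ → E}
    (hu : MemLp u 2 (expMeasure ω)) : MemLp u 2 ((volume : Measure ℝ).restrict (Ioi 0)) := by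
  refine ⟨hu.1.mono_ac (restrict_Ioi_absolutelyContinuous_expMeasure ω), ?_⟩
  have h : eLpNorm u 2 ((volume : Measure ℝ).restrict (Ioi 0)) ^ 2
      ≤ eLpNorm u 2 (expMeasure ω) ^ 2 := by
    rw [eLpNorm_expMeasure_sq, eLpNorm_two_sq]
    refine setLIntegral_mono' measurableSet_Ioi fun s hs => le_mul_of_one_le_left zero_le ?_
    rw [ENNReal.one_le_ofReal, Real.one_le_exp_iff]
    have : (0 : ℝ) ≤ s := le_of_lt hs
    positivity
  exact ((ENNReal.pow_le_pow_left_iff two_ne_zero).1 h).trans_lt hu.2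

theorem L2loc_of_memLp_restrict_Ioi {u : ℝ → E}
    (hu : MemLp u 2 ((volume : Measure ℝ).restrict (Ioi 0))) : L2loc u := fun _ =>
  hu.mono_measure (Measure.restrict_mono Ioc_subset_Ioi_self le_rfl)

theorem L2loc_of_memLp_expMeasure {ω : ℝ} (hω : 0 ≤ ω) {u : ℝ → E}
    (hu : MemLp u 2 (expMeasure ω)) : L2loc u :=
  L2loc_of_memLp_restrict_Ioi (memLp_restrict_Ioi_of_expMeasure hω hu)

theorem ae_eq_restrict_Ioc_of_expMeasure {E : Type*} {ω : ℝ} {u v : ℝ → E} (h : u =ᵐ[expMeasure ω] v)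
    (t : ℝ≥0) : u =ᵐ[volume.restrict (Ioc 0 (t : ℝ))] v :=
  ae_restrict_of_ae_restrict_of_subset Ioc_subset_Ioi_self
    ((restrict_Ioi_absolutelyContinuous_expMeasure ω).ae_le h)

theorem eLpNorm_expWeight (𝕜 : Type*) [RCLike 𝕜] [NormedSpace 𝕜 E] (ω : ℝ) (u : ℝ → E) :
    eLpNorm (expWeight 𝕜 ω u) 2 ((volume : Measure ℝ).restrict (Ioi 0))
      = eLpNorm u 2 (expMeasure ω) := by
  suffices h : eLpNorm (expWeight 𝕜 ω u) 2 ((volume : Measure ℝ).restrict (Ioi 0)) ^ 2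
      = eLpNorm u 2 (expMeasure ω) ^ 2 from
    le_antisymm ((ENNReal.pow_le_pow_left_iff two_ne_zero).1 h.le)
      ((ENNReal.pow_le_pow_left_iff two_ne_zero).1 h.ge)
  rw [eLpNorm_expMeasure_sq, eLpNorm_two_sq]
  refine lintegral_congr fun s => ?_
  have : ‖((Real.exp (ω * s) : ℝ) : 𝕜)‖ₑ = ENNReal.ofReal (Real.exp (ω * s)) := by
    rw [← ofReal_norm, RCLike.norm_ofReal, abs_of_nonneg (Real.exp_nonneg _)]
  rw [expWeight, enorm_smul, mul_pow, this, ← ENNReal.ofReal_pow (Real.exp_nonneg _),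
    ← Real.exp_nat_mul]
  congr 3
  push_cast
  ring

variable {𝕜 X Y : Type*} [RCLike 𝕜] [NormedSpace 𝕜 E] [NormedAddCommGroup X] [NormedSpace 𝕜 X]
  [NormedAddCommGroup Y] [NormedSpace 𝕜 Y]

theorem aestronglyMeasurable_bilinear (N : X →L[𝕜] Y →L[𝕜] E) {z : ℝ → X} {y : ℝ → Y} {ω : ℝ}
    (hz : ContinuousOn z (Ici 0)) (hy : AEStronglyMeasurable y (expMeasure ω)) :
    AEStronglyMeasurable (fun s => N (z s) (y s)) (expMeasure ω) :=
  N.aestronglyMeasurable_comp₂ (((hz.mono Ioi_subset_Ici_self).aestronglyMeasurable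
    measurableSet_Ioi).mono_ac (expMeasure_absolutelyContinuous ω)) hy

theorem eLpNorm_bilinear_le (N : X →L[𝕜] Y →L[𝕜] E) {z : ℝ → X} {y : ℝ → Y} {ω : ℝ} {a : ℝ≥0}
    (hz : ∀ s, 0 < s → ‖z s‖ₑ ≤ a) :
    eLpNorm (fun s => N (z s) (y s)) 2 (expMeasure ω)
      ≤ ‖N‖ₑ * a * eLpNorm y 2 (expMeasure ω) := by
  rw [← ENNReal.pow_le_pow_left_iff two_ne_zero, mul_pow, eLpNorm_expMeasure_sq,
    eLpNorm_expMeasure_sq]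
  rw [← lintegral_const_mul' _ _ (by finiteness)]
  refine setLIntegral_mono' measurableSet_Ioi fun s hs => ?_
  rw [mul_left_comm, ← mul_pow]
  gcongr
  refine (N.le_opENorm₂ _ _).trans ?_
  gcongr
  exact hz s hs

end Weighted

/-! ### Stable systems and existence for the bilinear feedback -/

namespace LinearSystem

variable {𝕜 X U Y : Type*} [RCLike 𝕜]
  [NormedAddCommGroup X] [NormedSpace 𝕜 X]
  [NormedAddCommGroup U] [NormedSpace 𝕜 U]
  [NormedAddCommGroup Y] [NormedSpace 𝕜 Y]

/-- `S` is a stable system, with gain `d`, for the weight `e^{ω·}`. -/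
def HasGain (S : LinearSystem 𝕜 X U Y) (ω : ℝ) (d : ℝ≥0) : Prop :=
  ∀ t x, ∀ v : L2 t U, S.totalEnergy ω t x v ≤ (d : ℝ≥0∞) ^ 2 * (‖x‖ₑ ^ 2 + energy ω t v)

theorem exists_hasGain (S : LinearSystem 𝕜 X U Y) {M lam ω : ℝ}
    (hT : ∀ t, ‖S.T t‖ ≤ M * Real.exp (-lam * t)) (hω : 0 ≤ ω) (hωlam : ω < lam) :
    ∃ d, S.HasGain ω d := by
  obtain ⟨c, hc⟩ := S.exists_totalEnergy_le hT hω hωlam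
  refine ⟨c + 1, fun t x v => (hc t x v).trans ?_⟩
  gcongr
  norm_cast
  nlinarith [c.2]

variable {S : LinearSystem 𝕜 X U Y} {ω : ℝ} {d : ℝ≥0} {x₀ : X} {u : ℝ → U} {z : ℝ → X} {y : ℝ → Y}

theorem HasGain.energy_le (hS : S.HasGain ω d) (h : S.IsTrajectory x₀ u z y) (t : ℝ≥0) :
    ENNReal.ofReal (Real.exp (2 * ω * t)) * ‖z t‖ₑ ^ 2 + energy ω t y
      ≤ (d : ℝ≥0∞) ^ 2 * (‖x₀‖ₑ ^ 2 + energy ω t u) :=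
  IsTrajectory.energy_le (c := d ^ 2) (by exact_mod_cast hS) h t

theorem HasGain.energy_le_eLpNorm (hS : S.HasGain ω d) (h : S.IsTrajectory x₀ u z y) (t : ℝ≥0) :
    ENNReal.ofReal (Real.exp (2 * ω * t)) * ‖z t‖ₑ ^ 2 + energy ω t y
      ≤ ((d : ℝ≥0∞) * (‖x₀‖ₑ + eLpNorm u 2 (expMeasure ω))) ^ 2 := by
  refine (hS.energy_le h t).trans ?_
  rw [mul_pow]
  gcongr
  refine (add_le_add_right (energy_le_eLpNorm_sq ω t u) _).trans ?_
  rw [add_sq]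
  gcongr
  exact le_self_add

theorem HasGain.enorm_state_le (hS : S.HasGain ω d) (h : S.IsTrajectory x₀ u z y) {t : ℝ}
    (ht : 0 ≤ t) : ENNReal.ofReal (Real.exp (ω * t)) * ‖z t‖ₑ
      ≤ d * (‖x₀‖ₑ + eLpNorm u 2 (expMeasure ω)) := by
  lift t to ℝ≥0 using ht
  rw [← ENNReal.pow_le_pow_left_iff two_ne_zero]
  refine le_trans (le_of_eq ?_) (le_self_add.trans (hS.energy_le_eLpNorm h t))
  have h₂ : ((2 : ℕ) : ℝ) * (ω * t) = 2 * ω * t := by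
    push_cast
    ring
  rw [mul_pow, ← ENNReal.ofReal_pow (Real.exp_nonneg _), ← Real.exp_nat_mul, h₂]

theorem HasGain.eLpNorm_output_le (hS : S.HasGain ω d) (h : S.IsTrajectory x₀ u z y) :
    eLpNorm y 2 (expMeasure ω) ≤ d * (‖x₀‖ₑ + eLpNorm u 2 (expMeasure ω)) := by
  rw [← ENNReal.pow_le_pow_left_iff two_ne_zero]
  exact eLpNorm_sq_le_of_energy_le fun t => le_add_self.trans (hS.energy_le_eLpNorm h t)

/-- Existence for the bilinear feedback, driven by given parts `z₁`, `y₁` of the state and of the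
output: on the ball of radius `r` of `L²_ω`, the map which sends the input `v` to
`N (z₁ + z, y₁ + y)`, for the trajectory `z`, `y` of `v`, is a contraction. -/
theorem HasGain.exists_feedback [CompleteSpace U] (hS : S.HasGain ω d) (hω : 0 ≤ ω)
    (N : X →L[𝕜] Y →L[𝕜] U) {z₁ : ℝ → X} {y₁ : ℝ → Y} (hz₁c : ContinuousOn z₁ (Ici 0))
    (hy₁ : MemLp y₁ 2 (expMeasure ω)) {a b r : ℝ≥0} (hz₁ : ∀ s, 0 < s → ‖z₁ s‖ₑ ≤ a)
    (hy₁a : eLpNorm y₁ 2 (expMeasure ω) ≤ a) (hb : a + d * r ≤ b) (hbr : ‖N‖₊ * b * b ≤ r)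
    (hcontr : 2 * ‖N‖₊ * d * b ≤ 1 / 2) :
    ∃ z y, S.IsTrajectory 0 (fun s => N (z₁ s + z s) (y₁ s + y s)) z y ∧
      MemLp (fun s => N (z₁ s + z s) (y₁ s + y s)) 2 (expMeasure ω) ∧
      eLpNorm (fun s => N (z₁ s + z s) (y₁ s + y s)) 2 (expMeasure ω) ≤ r := by
  have htraj : ∀ v : Lp U 2 (expMeasure ω), ∃ z y, S.IsTrajectory 0 v z y := fun v =>
    S.exists_isTrajectory 0 (L2loc_of_memLp_expMeasure hω (Lp.memLp v))
  choose Z Y' hZY using htraj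
  -- the estimates for a single input and for the difference of two inputs
  have hZ : ∀ v s, 0 < s → ‖Z v s‖ₑ ≤ d * ‖v‖ₑ := fun v s hs => by
    have := enorm_le_of_weighted hω hs.le (hS.enorm_state_le (hZY v) hs.le)
    rwa [enorm_zero, zero_add, ← Lp.enorm_def] at this
  have hY : ∀ v, eLpNorm (Y' v) 2 (expMeasure ω) ≤ d * ‖v‖ₑ := fun v => by
    have := hS.eLpNorm_output_le (hZY v)
    rwa [enorm_zero, zero_add, ← Lp.enorm_def] at this
  have hZd : ∀ v w s, 0 < s → ‖(Z v - Z w) s‖ₑ ≤ d * edist v w := fun v w s hs => by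
    have := enorm_le_of_weighted hω hs.le (hS.enorm_state_le ((hZY v).sub (hZY w)) hs.le)
    rwa [sub_zero, enorm_zero, zero_add, ← Lp.edist_def] at this
  have hYd : ∀ v w, eLpNorm (Y' v - Y' w) 2 (expMeasure ω) ≤ d * edist v w := fun v w => by
    have := hS.eLpNorm_output_le ((hZY v).sub (hZY w))
    rwa [sub_zero, enorm_zero, zero_add, ← Lp.edist_def] at this
  have hYm : ∀ v, MemLp (Y' v) 2 (expMeasure ω) := fun v =>
    (hZY v).output_mem.memLp_expMeasure ((hY v).trans_lt (by finiteness))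
  have hbound : ∀ v : Lp U 2 (expMeasure ω), ‖v‖ₑ ≤ r → a + d * ‖v‖ₑ ≤ b := fun v hv => by
    refine le_trans ?_ (by exact_mod_cast hb : (a : ℝ≥0∞) + d * r ≤ b)
    gcongr
  have hzb : ∀ v : Lp U 2 (expMeasure ω), ∀ s, 0 < s →
      ‖z₁ s + Z v s‖ₑ ≤ (a + d * ‖v‖₊ : ℝ≥0) := fun v s hs => by
    push_cast
    exact (enorm_add_le _ _).trans (add_le_add (hz₁ s hs) (hZ v s hs))
  have hyb : ∀ v : Lp U 2 (expMeasure ω),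
      eLpNorm (fun s => y₁ s + Y' v s) 2 (expMeasure ω) ≤ a + d * ‖v‖ₑ := fun v =>
    (eLpNorm_add_le hy₁.1 (hYm v).1 one_le_two).trans (add_le_add hy₁a (hY v))
  have hmeas : ∀ v, AEStronglyMeasurable (fun s => N (z₁ s + Z v s) (y₁ s + Y' v s))
      (expMeasure ω) := fun v =>
    aestronglyMeasurable_bilinear N (hz₁c.add (hZY v).continuousOn) (hy₁.1.add (hYm v).1)
  have hle : ∀ v, eLpNorm (fun s => N (z₁ s + Z v s) (y₁ s + Y' v s)) 2 (expMeasure ω)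
      ≤ ‖N‖ₑ * (a + d * ‖v‖ₑ) * (a + d * ‖v‖ₑ) := fun v => by
    refine (eLpNorm_bilinear_le N (hzb v)).trans ?_
    push_cast
    exact mul_le_mul_right (hyb v) _
  have hmem : ∀ v, MemLp (fun s => N (z₁ s + Z v s) (y₁ s + Y' v s)) 2 (expMeasure ω) := fun v =>
    ⟨hmeas v, (hle v).trans_lt (by finiteness)⟩
  set P : Lp U 2 (expMeasure ω) → Lp U 2 (expMeasure ω) := fun v => (hmem v).toLp _ with hP
  set K : Set (Lp U 2 (expMeasure ω)) := {v | ‖v‖ₑ ≤ r} with hK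
  have hKc : IsComplete K := (isClosed_le continuous_enorm continuous_const).isComplete
  have hmaps : MapsTo P K K := fun v hv => by
    change ‖(hmem v).toLp _‖ₑ ≤ r
    rw [Lp.enorm_toLp]
    refine (hle v).trans (le_trans ?_ (by exact_mod_cast hbr : (‖N‖₊ : ℝ≥0∞) * b * b ≤ r))
    rw [enorm_eq_nnnorm N]
    gcongr <;> exact hbound v hv
  have hlip : ContractingWith (1 / 2) (hmaps.restrict P K K) := by
    refine ⟨by norm_num, fun v w => ?_⟩
    change edist ((hmem v).toLp _) ((hmem w).toLp _) ≤ _ * edist v.1 w.1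
    rw [Lp.edist_toLp_toLp]
    have hsplit : ((fun s => N (z₁ s + Z v s) (y₁ s + Y' v s))
        - fun s => N (z₁ s + Z w s) (y₁ s + Y' w s))
        = (fun s => N ((Z v - Z w) s) (y₁ s + Y' v s))
          + fun s => N (z₁ s + Z w s) ((Y' v - Y' w) s) := by
      ext s
      simp only [Pi.sub_apply, Pi.add_apply, map_add, map_sub, add_apply,
        sub_apply]
      abel
    have hfin : edist v.1 w.1 ≠ ⊤ := edist_ne_top _ _
    have hd : ((d * (edist v.1 w.1).toNNReal : ℝ≥0) : ℝ≥0∞) = d * edist v.1 w.1 := by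
      rw [ENNReal.coe_mul, ENNReal.coe_toNNReal hfin]
    rw [hsplit]
    refine (eLpNorm_add_le
      (aestronglyMeasurable_bilinear N ((hZY v).continuousOn.sub (hZY w).continuousOn)
        (hy₁.1.add (hYm v).1))
      (aestronglyMeasurable_bilinear N (hz₁c.add (hZY w).continuousOn)
        ((hYm v).1.sub (hYm w).1)) one_le_two).trans ?_
    calc _ ≤ ‖N‖ₑ * ((d * (edist v.1 w.1).toNNReal : ℝ≥0) : ℝ≥0∞) * b
          + ‖N‖ₑ * ((b : ℝ≥0) : ℝ≥0∞) * (d * edist v.1 w.1) := by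
          refine add_le_add ?_ ?_
          · refine (eLpNorm_bilinear_le N fun s hs => ?_).trans
              (mul_le_mul_right ((hyb v).trans (hbound v v.2)) _)
            rw [hd]
            exact hZd v w s hs
          · refine (eLpNorm_bilinear_le N fun s hs => ?_).trans
              (mul_le_mul_right (hYd v w) _)
            exact (hzb w s hs).trans (by push_cast; exact hbound w w.2)
      _ = (2 * ‖N‖₊ * d * b : ℝ≥0) * edist v.1 w.1 := by
          rw [hd, enorm_eq_nnnorm]
          push_cast
          ring
      _ ≤ _ := by
          gcongr
  obtain ⟨v, hvK, hv, -⟩ := hlip.exists_fixedPoint' hKc hmaps (x := 0)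
    (by simp [hK]) (edist_ne_top _ _)
  have hvP : (v : ℝ → U) =ᵐ[expMeasure ω] fun s => N (z₁ s + Z v s) (y₁ s + Y' v s) := by
    conv_lhs => rw [← hv.eq]
    exact (hmem v).coeFn_toLp
  refine ⟨Z v, Y' v, (hZY v).congr_input (ae_eq_restrict_Ioc_of_expMeasure hvP), hmem v, ?_⟩
  rw [← eLpNorm_congr_ae hvP, ← Lp.enorm_def]
  exact hvK

end LinearSystem

/-! ### Uniqueness for the bilinear feedback -/

namespace LinearSystem

variable {𝕜 X U Y : Type*} [RCLike 𝕜]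
  [NormedAddCommGroup X] [NormedSpace 𝕜 X]
  [NormedAddCommGroup U] [NormedSpace 𝕜 U]
  [NormedAddCommGroup Y] [NormedSpace 𝕜 Y]
  {S : LinearSystem 𝕜 X U Y} {ω : ℝ} {d : ℝ≥0} {u : ℝ → U} {w : ℝ → X} {v : ℝ → Y}

theorem HasGain.eq_zero (hS : S.HasGain ω d) (h : S.IsTrajectory 0 u w v)
    (hu : ∀ t, energy ω t u = 0) :
    (∀ t, 0 ≤ t → w t = 0) ∧ v =ᵐ[(volume : Measure ℝ).restrict (Ioi 0)] 0 := by
  have hle : ∀ t : ℝ≥0, ENNReal.ofReal (Real.exp (2 * ω * t)) * ‖w t‖ₑ ^ 2 + energy ω t v ≤ 0 :=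
    fun t => (hS.energy_le h t).trans (by simp [hu])
  refine ⟨fun t ht => ?_, ?_⟩
  · lift t to ℝ≥0 using ht
    have h0 := le_self_add.trans (hle t)
    simpa [(Real.exp_pos _).not_ge] using h0
  · have h0 := eLpNorm_sq_le_of_energy_le fun t => le_add_self.trans (hle t)
    rw [nonpos_iff_eq_zero, sq_eq_zero_iff, eLpNorm_eq_zero_iff
      (h.output_mem.aestronglyMeasurable.mono_ac (expMeasure_absolutelyContinuous ω))
      two_ne_zero] at h0
    exact (restrict_Ioi_absolutelyContinuous_expMeasure ω).ae_le h0

/-- If the input of a trajectory with initial state `0` is bounded by the trajectory itself, with an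
integrable coefficient `g` of the state and a small coefficient `κ` of the output, and vanishes up
to time `a`, then it vanishes as long as the integral of `g` after time `a` is small. -/
theorem HasGain.energy_eq_zero_step (hS : S.HasGain ω d) (hω : 0 ≤ ω)
    (h : S.IsTrajectory 0 u w v) {g : ℝ → ℝ≥0∞} {κ : ℝ≥0}
    (hu : ∀ s, 0 < s → ‖u s‖ₑ ^ 2 ≤ g s * ‖w s‖ₑ ^ 2 + κ * ‖v s‖ₑ ^ 2)
    (hκ : κ * d ^ 2 ≤ 1 / 4) {a t : ℝ≥0} (hat : a ≤ t)
    (hg : AEMeasurable g (volume.restrict (Ioc (a : ℝ) t))) (ha : energy ω a u = 0)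
    (hgd : (∫⁻ s in Ioc (a : ℝ) t, g s) * d ^ 2 ≤ 1 / 4) : energy ω t u = 0 := by
  have hfin : energy ω t u ≠ ⊤ := h.input_mem.energy_ne_top hω t
  have hκ' : (κ : ℝ≥0∞) * d ^ 2 ≤ 1 / 4 := by
    simpa using ENNReal.coe_le_coe.2 hκ
  have hbd : ∀ s : ℝ≥0, s ≤ t → ENNReal.ofReal (Real.exp (2 * ω * s)) * ‖w s‖ₑ ^ 2
      + energy ω s v ≤ d ^ 2 * energy ω t u := fun s hs => by
    refine (hS.energy_le h s).trans ?_
    rw [enorm_zero, zero_pow two_ne_zero, zero_add]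
    gcongr
    exact energy_mono ω hs u
  have hhalf : energy ω t u ≤ energy ω t u / 2 := by
    calc energy ω t u
        = ∫⁻ s in Ioc (a : ℝ) t, ENNReal.ofReal (Real.exp (2 * ω * s)) * ‖u s‖ₑ ^ 2 := by
          rw [energy, ← Ioc_union_Ioc_eq_Ioc a.coe_nonneg (NNReal.coe_le_coe.2 hat),
            lintegral_union measurableSet_Ioc (Ioc_disjoint_Ioc_of_le le_rfl)]
          exact (congrArg (· + _) ha).trans (zero_add _)
      _ ≤ ∫⁻ s in Ioc (a : ℝ) t, (g s * (d ^ 2 * energy ω t u)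
            + κ * (ENNReal.ofReal (Real.exp (2 * ω * s)) * ‖v s‖ₑ ^ 2)) := by
          refine setLIntegral_mono' measurableSet_Ioc fun s hs => ?_
          have hs0 : 0 < s := a.coe_nonneg.trans_lt hs.1
          have hw := le_self_add.trans (hbd ⟨s, hs0.le⟩ hs.2)
          calc ENNReal.ofReal (Real.exp (2 * ω * s)) * ‖u s‖ₑ ^ 2
              ≤ ENNReal.ofReal (Real.exp (2 * ω * s))
                * (g s * ‖w s‖ₑ ^ 2 + κ * ‖v s‖ₑ ^ 2) := by
                gcongr
                exact hu s hs0
            _ = g s * (ENNReal.ofReal (Real.exp (2 * ω * s)) * ‖w s‖ₑ ^ 2)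
                + κ * (ENNReal.ofReal (Real.exp (2 * ω * s)) * ‖v s‖ₑ ^ 2) := by ring
            _ ≤ _ := by
                exact add_le_add (mul_le_mul_right hw _) le_rfl
      _ = (∫⁻ s in Ioc (a : ℝ) t, g s) * (d ^ 2 * energy ω t u)
            + κ * ∫⁻ s in Ioc (a : ℝ) t, ENNReal.ofReal (Real.exp (2 * ω * s)) * ‖v s‖ₑ ^ 2 := by
          rw [lintegral_add_left' (hg.mul_const _), lintegral_mul_const' _ _ (by finiteness),
            lintegral_const_mul' _ _ (by finiteness)]
      _ ≤ (∫⁻ s in Ioc (a : ℝ) t, g s) * (d ^ 2 * energy ω t u)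
            + κ * (d ^ 2 * energy ω t u) := by
          gcongr
          exact (lintegral_mono_set (Ioc_subset_Ioc_left a.coe_nonneg)).trans
            (le_add_self.trans (hbd t le_rfl))
      _ = ((∫⁻ s in Ioc (a : ℝ) t, g s) * d ^ 2 + κ * d ^ 2) * energy ω t u := by ring
      _ ≤ (1 / 4 + 1 / 4) * energy ω t u := by gcongr
      _ = energy ω t u / 2 := by
          have hq : (1 / 4 + 1 / 4 : ℝ≥0∞) = 2⁻¹ := by
            rw [← ENNReal.toReal_eq_toReal_iff' (by finiteness) (by finiteness),
              ENNReal.toReal_add (by finiteness) (by finiteness)]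
            norm_num
          rw [hq, ENNReal.div_eq_inv_mul]
  by_contra h0
  exact (ENNReal.half_lt_self h0 hfin).not_ge hhalf

/-- A trajectory with initial state `0` has zero input if the input is bounded by the trajectory
itself, with an integrable coefficient `g` of the state and a small coefficient `κ` of the output:
every bounded interval consists of finitely many intervals on which the integral of `g` is small. -/
theorem HasGain.energy_eq_zero (hS : S.HasGain ω d) (hω : 0 ≤ ω) (h : S.IsTrajectory 0 u w v)
    {g : ℝ → ℝ≥0∞} {κ : ℝ≥0}
    (hg : ∀ t : ℝ≥0, AEMeasurable g (volume.restrict (Ioc 0 (t : ℝ))))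
    (hgt : ∀ t : ℝ≥0, ∫⁻ s in Ioc 0 (t : ℝ), g s ≠ ⊤)
    (hu : ∀ s, 0 < s → ‖u s‖ₑ ^ 2 ≤ g s * ‖w s‖ₑ ^ 2 + κ * ‖v s‖ₑ ^ 2)
    (hκ : κ * d ^ 2 ≤ 1 / 4) (t : ℝ≥0) : energy ω t u = 0 := by
  obtain ⟨η, hη0, hη⟩ : ∃ η : ℝ≥0, 0 < η ∧ η * d ^ 2 ≤ 1 / 4 := by
    refine ⟨1 / (4 * (d ^ 2 + 1)), by positivity, ?_⟩
    rw [div_mul_eq_mul_div, one_mul, div_le_div_iff₀ (by positivity) (by norm_num), one_mul,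
      mul_comm]
    gcongr
    exact le_self_add
  have hηd : (η : ℝ≥0∞) * d ^ 2 ≤ 1 / 4 := by
    simpa using ENNReal.coe_le_coe.2 hη
  -- the integral of `g` is less than `η` on each interval of length at most `r`
  obtain ⟨δ, hδ, hsmall⟩ := exists_pos_setLIntegral_lt_of_measure_lt (hgt t)
    (ENNReal.coe_pos.2 hη0).ne'
  obtain ⟨r, hr0, hrδ⟩ := ENNReal.lt_iff_exists_nnreal_btwn.1 hδ
  have hr0 : 0 < r := ENNReal.coe_pos.1 hr0
  have hn : ∀ n : ℕ, energy ω (min (n • r) t) u = 0 := by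
    intro n
    induction n with
    | zero => simp [energy]
    | succ n ih =>
      have hle : min (n • r) t ≤ min ((n + 1) • r) t := by
        refine min_le_min_right t ?_
        rw [succ_nsmul]
        exact le_self_add
      have hsub : Ioc ((min (n • r) t : ℝ≥0) : ℝ) ((min ((n + 1) • r) t : ℝ≥0) : ℝ)
          ⊆ Ioc 0 (t : ℝ) :=
        Ioc_subset_Ioc (NNReal.coe_nonneg _) (NNReal.coe_le_coe.2 (min_le_right _ _))
      refine hS.energy_eq_zero_step hω h hu hκ hle ((hg t).mono_measure
        (Measure.restrict_mono hsub le_rfl)) ih (le_trans ?_ hηd)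
      gcongr
      have hs := hsmall (Ioc ((min (n • r) t : ℝ≥0) : ℝ) ((min ((n + 1) • r) t : ℝ≥0) : ℝ)) ?_
      · rw [Measure.restrict_restrict_of_subset hsub] at hs
        exact hs.le
      · refine (Measure.restrict_apply_le _ _).trans_lt (lt_of_le_of_lt ?_ hrδ)
        rw [Real.volume_Ioc, ← ENNReal.ofReal_coe_nnreal]
        refine ENNReal.ofReal_le_ofReal ?_
        rw [sub_le_iff_le_add', ← NNReal.coe_add, NNReal.coe_le_coe, succ_nsmul, min_add]
        exact min_le_min le_rfl le_self_add
  obtain ⟨n, hnt⟩ := Archimedean.arch t hr0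
  have := hn n
  rwa [min_eq_right hnt] at this

end LinearSystem

/-! ### The closed-loop system -/

theorem growthBound_le {𝕜 X : Type*} [RCLike 𝕜] [NormedAddCommGroup X] [NormedSpace 𝕜 X]
    {T : C0Semigroup 𝕜 X} {M v : ℝ} (hT : ∀ t : ℝ≥0, ‖T t‖ ≤ M * Real.exp (v * t)) :
    T.growthBound ≤ (v : EReal) :=
  sInf_le ⟨v, ⟨M, hT⟩, rfl⟩

theorem enorm_bilinear_sub_sq_le {𝕜 X Y U : Type*} [RCLike 𝕜]
    [NormedAddCommGroup X] [NormedSpace 𝕜 X] [NormedAddCommGroup U] [NormedSpace 𝕜 U]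
    [NormedAddCommGroup Y] [NormedSpace 𝕜 Y] (N : X →L[𝕜] Y →L[𝕜] U) (x x' : X) (y y' : Y) :
    ‖N x' y' - N x y‖ₑ ^ 2 ≤ 2 * (‖N‖ₑ * ‖y'‖ₑ) ^ 2 * ‖x' - x‖ₑ ^ 2
      + 2 * (‖N‖ₑ * ‖x‖ₑ) ^ 2 * ‖y' - y‖ₑ ^ 2 := by
  have h : N x' y' - N x y = N (x' - x) y' + N x (y' - y) := by
    simp only [map_sub, sub_apply]
    abel
  rw [h]
  refine (enorm_add_sq_le _ _).trans ?_
  calc 2 * (‖N (x' - x) y'‖ₑ ^ 2 + ‖N x (y' - y)‖ₑ ^ 2)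
      ≤ 2 * ((‖N‖ₑ * ‖x' - x‖ₑ * ‖y'‖ₑ) ^ 2 + (‖N‖ₑ * ‖x‖ₑ * ‖y' - y‖ₑ) ^ 2) := by
        gcongr <;> exact N.le_opENorm₂ _ _
    _ = _ := by ring

end BilinearFeedback

end

open BilinearFeedback

theorem mainTheorem2 {𝕜 X U₁ U₂ Y : Type*} [RCLike 𝕜]
    [NormedAddCommGroup X] [NormedSpace 𝕜 X] [CompleteSpace X]
    [NormedAddCommGroup U₁] [NormedSpace 𝕜 U₁] [CompleteSpace U₁]
    [NormedAddCommGroup U₂] [NormedSpace 𝕜 U₂] [CompleteSpace U₂]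
    [NormedAddCommGroup Y] [NormedSpace 𝕜 Y] [CompleteSpace Y]
    -- the semigroup, with generator `A = T.generator`, and a point `β ∈ ρ(A)`
    (T : C0Semigroup 𝕜 X) (β : T.resolventSet)
    -- control and observation operators
    (B₁ : U₁ →L[𝕜] T.Xm1 β) (B₂ : U₂ →L[𝕜] T.Xm1 β) (C : T.X1 β →L[𝕜] Y)
    -- `Y ⊆ X` with continuous embedding `j`, and `C` extends to a bounded operator on `X`
    (j : Y →L[𝕜] X) (_hj : Function.Injective j)
    (CX : X →L[𝕜] X) (_hCX : ∀ x : T.X1 β, CX (C0Semigroup.X1.incl T β x) = j (C x))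
    -- the bilinear feedback
    (N : X →L[𝕜] Y →L[𝕜] U₂) (K p : ℝ) (_hK : 0 < K) (_hp : p ∈ Set.Ioo (0 : ℝ) 1)
    (_hN : ∀ z y, ‖N z y‖ ≤ K * ‖z‖ * ‖j y‖ ^ (1 - p) * ‖y‖ ^ p)
    -- exponential stability
    (M lam : ℝ) (_hM : 0 < M) (_hlam : 0 < lam)
    (_hT : ∀ t : ℝ≥0, ‖T t‖ ≤ M * Real.exp (-lam * t))
    -- well-posedness of the associated linear system, with transfer functions `G₁`, `G₂`
    (G₁ : 𝕜 → U₁ →L[𝕜] Y) (G₂ : 𝕜 → U₂ →L[𝕜] Y)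
    (_hwp : WellPosed T β B₁ B₂ C G₁ G₂) :
    ∀ ω ∈ Set.Ioo 0 lam, ∃ k : ℝ, 0 < k ∧ ∃ ε₀ : ℝ, 0 < ε₀ ∧ ∀ ε ∈ Set.Ioc 0 ε₀,
      ∀ (z₀ : X) (u₁ : ℝ → U₁), MemL2Weighted 𝕜 ω u₁ → ‖z₀‖ + normL2Weighted 𝕜 ω u₁ ≤ ε →
        ∃ (z : ℝ → X) (y : ℝ → Y),
          IsSolution T β B₁ B₂ C G₁ G₂ N z₀ u₁ z y ∧
          (∃ c : ℝ, ∀ t : ℝ, 0 ≤ t → ‖z t‖ ≤ c) ∧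
          MemLp y 2 ((volume : Measure ℝ).restrict (Set.Ioi 0)) ∧
          (∀ t : ℝ, 0 ≤ t → ‖z t‖ ≤ k * ε * Real.exp (-ω * t)) ∧
          ∀ (z' : ℝ → X) (y' : ℝ → Y), IsSolution T β B₁ B₂ C G₁ G₂ N z₀ u₁ z' y' →
            Set.EqOn z' z (Set.Ici 0) ∧
              y' =ᵐ[(volume : Measure ℝ).restrict (Set.Ioi 0)] y := by
  rintro ω ⟨hω, hωlam⟩
  have hM : ∀ t, ‖T t‖ ≤ M := fun t => (_hT t).trans
    (mul_le_of_le_one_right _hM.le (Real.exp_le_one_iff.2 (by nlinarith [t.coe_nonneg])))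
  have hα : T.rightHalfPlane.Nonempty := by
    refine ⟨0, (growthBound_le _hT).trans_lt ?_⟩
    rw [map_zero]
    exact EReal.coe_lt_coe_iff.2 (neg_lt_zero.2 _hlam)
  let S₁ := LinearSystem.ofWellPosed hM hα _hwp.control₁ _hwp.observation _hwp.inputOutput₁
  let S₂ := LinearSystem.ofWellPosed hM hα _hwp.control₂ _hwp.observation _hwp.inputOutput₂
  obtain ⟨d₁, hd₁⟩ := S₁.exists_hasGain (ω := ω) _hT hω.le hωlam
  obtain ⟨d₂, hd₂⟩ := S₂.exists_hasGain (ω := ω) _hT hω.le hωlam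
  -- `D * ε` bounds the state and the output in the weighted norms if `N(z,y)` has norm at most `ε`
  set D : ℝ≥0 := d₁ + d₂ + 1 with hD
  have hdD : d₂ ≤ D := le_add_self.trans le_self_add
  have hD0 : 0 < D := by positivity
  set ε₀ : ℝ≥0 := (4 * (‖N‖₊ + 1) * D ^ 2)⁻¹ with hε₀
  have hε₀0 : 0 < ε₀ := by positivity
  refine ⟨D, hD0, ε₀, hε₀0, ?_⟩
  rintro ε ⟨hε0, hε⟩ z₀ u₁ ⟨hu₁, hu₁ω⟩ hsmall
  lift ε to ℝ≥0 using hε0.le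
  have hε : ε ≤ ε₀ := hε
  have hsm : ‖N‖₊ * D ^ 2 * ε ≤ 1 / 4 := by
    calc ‖N‖₊ * D ^ 2 * ε ≤ (‖N‖₊ + 1) * D ^ 2 * ε₀ := by
          gcongr
          exact le_self_add
      _ = 1 / 4 := by rw [hε₀]; field_simp
  -- the linear part of the solution
  have hnorm : ‖z₀‖ₑ + eLpNorm u₁ 2 (expMeasure ω) ≤ ε := by
    rw [← eLpNorm_expWeight 𝕜, ← ENNReal.ofReal_toReal hu₁ω.2.ne, ← ofReal_norm,
      ← ENNReal.ofReal_add (norm_nonneg _) ENNReal.toReal_nonneg, ← ENNReal.ofReal_coe_nnreal]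
    exact ENNReal.ofReal_le_ofReal hsmall
  have hu₁loc : L2loc u₁ := L2loc_of_memLp_restrict_Ioi hu₁
  obtain ⟨z₁, y₁, h₁⟩ := S₁.exists_isTrajectory z₀ hu₁loc
  have hz₁ : ∀ s : ℝ, 0 ≤ s → ENNReal.ofReal (Real.exp (ω * s)) * ‖z₁ s‖ₑ ≤ (d₁ * ε : ℝ≥0) :=
    fun s hs => (hd₁.enorm_state_le h₁ hs).trans (by push_cast; gcongr)
  have hy₁ : eLpNorm y₁ 2 (expMeasure ω) ≤ (d₁ * ε : ℝ≥0) :=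
    (hd₁.eLpNorm_output_le h₁).trans (by push_cast; gcongr)
  have hy₁m : MemLp y₁ 2 (expMeasure ω) :=
    h₁.output_mem.memLp_expMeasure (hy₁.trans_lt ENNReal.coe_lt_top)
  -- the bilinear part
  obtain ⟨z₂, y₂, h₂, hmem, hnle⟩ := hd₂.exists_feedback (b := D * ε) (r := ε) hω.le N
    h₁.continuousOn hy₁m
    (fun s hs => enorm_le_of_weighted hω.le hs.le (hz₁ s hs.le)) hy₁
    (by
      rw [hD, ← add_mul]
      exact mul_le_mul_left le_self_add _)
    (by
      calc ‖N‖₊ * (D * ε) * (D * ε) = ‖N‖₊ * D ^ 2 * ε * ε := by ring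
        _ ≤ 1 * ε := by
          gcongr
          exact hsm.trans (by rw [← NNReal.coe_le_coe]; norm_num)
        _ = ε := one_mul ε)
    (by
      calc 2 * ‖N‖₊ * d₂ * (D * ε) ≤ 2 * ‖N‖₊ * D * (D * ε) := by
            gcongr
        _ = 2 * (‖N‖₊ * D ^ 2 * ε) := by ring
        _ ≤ 2 * (1 / 4) := by gcongr
        _ = 1 / 2 := by norm_num)
  set n : ℝ → U₂ := fun s => N (z₁ s + z₂ s) (y₁ s + y₂ s) with hn
  have hz : ∀ s : ℝ, 0 ≤ s →
      ENNReal.ofReal (Real.exp (ω * s)) * ‖z₁ s + z₂ s‖ₑ ≤ (D * ε : ℝ≥0) := fun s hs => by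
    have h2 := hd₂.enorm_state_le h₂ hs
    rw [enorm_zero, zero_add] at h2
    calc ENNReal.ofReal (Real.exp (ω * s)) * ‖z₁ s + z₂ s‖ₑ
        ≤ ENNReal.ofReal (Real.exp (ω * s)) * (‖z₁ s‖ₑ + ‖z₂ s‖ₑ) := by
          gcongr
          exact enorm_add_le _ _
      _ ≤ (d₁ * ε : ℝ≥0) + d₂ * ε := by
          rw [mul_add]
          exact add_le_add (hz₁ s hs) (h2.trans (by gcongr))
      _ ≤ (D * ε : ℝ≥0) := by
          rw [hD]
          push_cast
          rw [← add_mul]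
          exact mul_le_mul_left le_self_add _
  have hz' : ∀ t : ℝ, 0 ≤ t → ‖z₁ t + z₂ t‖ ≤ D * ε * Real.exp (-ω * t) := fun t ht => by
    have h := hz t ht
    rw [← ofReal_norm, ← ENNReal.ofReal_mul (Real.exp_nonneg _), ← ENNReal.ofReal_coe_nnreal,
      ENNReal.ofReal_le_ofReal_iff (NNReal.coe_nonneg _), NNReal.coe_mul] at h
    rw [neg_mul, Real.exp_neg, ← div_eq_mul_inv, le_div_iff₀ (Real.exp_pos _), mul_comm]
    exact h
  have hy₂m : MemLp y₂ 2 (expMeasure ω) := by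
    refine h₂.output_mem.memLp_expMeasure ((hd₂.eLpNorm_output_le h₂).trans_lt ?_)
    rw [enorm_zero, zero_add]
    exact ENNReal.mul_lt_top ENNReal.coe_lt_top hmem.2
  have hsol : IsSolution T β B₁ B₂ C G₁ G₂ N z₀ u₁ (z₁ + z₂) (y₁ + y₂) :=
    { input₁ := hu₁loc
      input₂ := h₂.input_mem
      continuousOn := h₁.continuousOn.add h₂.continuousOn
      output_mem := fun t => (h₁.output_mem t).add (h₂.output_mem t)
      state_eq := fun t => by
        rw [Pi.add_apply, h₁.state_eq, h₂.state_eq, LinearSystem.state, LinearSystem.state,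
          map_zero, zero_add]
        rfl
      output_eq := fun t => by
        rw [MemLp.toLp_add (h₁.output_mem t) (h₂.output_mem t), h₁.output_eq, h₂.output_eq,
          LinearSystem.output, LinearSystem.output, map_zero, zero_add]
        rfl }
  refine ⟨z₁ + z₂, y₁ + y₂, hsol, ⟨D * ε, fun t ht => (hz' t ht).trans ?_⟩,
    memLp_restrict_Ioi_of_expMeasure hω.le (hy₁m.add hy₂m), hz', fun z' y' hsol' => ?_⟩
  · exact mul_le_of_le_one_right (by positivity)
      (Real.exp_le_one_iff.2 (by nlinarith))
  -- the difference of two solutions is a trajectory of the second system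
  have hdiff : S₂.IsTrajectory 0 ((fun s => N (z' s) (y' s)) - n)
      (z' - (z₁ + z₂)) (y' - (y₁ + y₂)) :=
    { input_mem := fun t => (hsol'.input₂ t).sub (h₂.input_mem t)
      output_mem := fun t => (hsol'.output_mem t).sub (hsol.output_mem t)
      state_eq := fun t => by
        rw [Pi.sub_apply, hsol'.state_eq, hsol.state_eq, add_sub_add_left_eq_sub,
          LinearSystem.state, map_zero, zero_add,
          MemLp.toLp_sub (hsol'.input₂ t) (h₂.input_mem t), map_sub]
        rfl
      output_eq := fun t => by
        rw [MemLp.toLp_sub (hsol'.output_mem t) (hsol.output_mem t), hsol'.output_eq,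
          hsol.output_eq, add_sub_add_left_eq_sub, LinearSystem.output, map_zero, zero_add,
          MemLp.toLp_sub (hsol'.input₂ t) (h₂.input_mem t), map_sub]
        rfl }
  have hzero := hd₂.energy_eq_zero (g := fun s => 2 * (‖N‖ₑ * ‖y' s‖ₑ) ^ 2)
    (κ := 2 * (‖N‖₊ * (D * ε)) ^ 2) hω.le hdiff
    (fun t => (((hsol'.output_mem t).1.enorm.const_mul _).pow_const 2).const_mul 2)
    (fun t => by
      simp_rw [mul_pow]
      rw [lintegral_const_mul' _ _ (by finiteness), lintegral_const_mul' _ _ (by finiteness),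
        ← eLpNorm_two_sq]
      have := (hsol'.output_mem t).2
      finiteness)
    (fun s hs => by
      refine (enorm_bilinear_sub_sq_le N _ _ _ _).trans ?_
      push_cast
      rw [enorm_eq_nnnorm N]
      gcongr
      · exact le_rfl
      · exact_mod_cast enorm_le_of_weighted hω.le hs.le (hz s hs.le)
      · exact le_rfl)
    (by
      calc 2 * (‖N‖₊ * (D * ε)) ^ 2 * d₂ ^ 2 ≤ 2 * (‖N‖₊ * (D * ε)) ^ 2 * D ^ 2 := by
            gcongr
        _ = 2 * (‖N‖₊ * D ^ 2 * ε) ^ 2 := by ring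
        _ ≤ 2 * (1 / 4) ^ 2 := by gcongr
        _ ≤ 1 / 4 := by rw [← NNReal.coe_le_coe]; norm_num)
  obtain ⟨hz0, hy0⟩ := hd₂.eq_zero hdiff hzero
  refine ⟨fun t ht => sub_eq_zero.1 (hz0 t ht), ?_⟩
  filter_upwards [hy0] with s hs using sub_eq_zero.1 hs
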